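/- Let $(V,g)$ be a Euclidean vector space of finite dimension $n$ and let $C\ell(V)$ be its complex Clifford algebra, $vw+wv=-2g(v,w)$. Let $S$ be an irreducible Clifford module; elements of $C\ell(V)$ are read as endomorphisms of $S$, i.e. $C\ell(V)$ is identified with $\mathrm{End}(S)$ (so the volume element is $\pm 1$ if $n$ is odd). For an orthonormal basis $(e_\mu)$ of $V$ write $\Gamma_\mu$ for the action of $e_\mu$ on $S$, $\Gamma_I=\prod_{i\in I}\Gamma_i$ (increasing order) for $I\subset\{1,\dots,n\}$, $\hat I=|I|$, and $\Gamma^*=i^{[(n+1)/2]}\Gamma_{1\dots n}$. Put $s_{a,b}(x)=ax-xb$ and $q_{a,b}(x)=a^2x+xb^2-2axb$. A pair $(a,b)$ is a quadratic Clifford pair associated to the symmetric map $B\in\mathrm{End}(V)$ if $q_{a,b}(v)=B(v)$ for all $v\in V$. Let $\mathfrak{so}_B(V)$ be the space of skew-symmetric endomorphisms of $V$ that commute with $B$; it acts on $C\ell(V)$ by commutators through $\mathfrak{so}(V)\cong C\ell_2(V)$. Let $(c,d)$ be a quadratic Clifford pair associated to the symmetric map $B$ such that $c$ and $d$ are invariant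 under $\mathfrak{so}_B(V)$, and let $\Omega_{c,d}(v,w)=s_{d,c}(v)w+ws_{c,d}(v)$. Then $\Omega_{c,d}\in\mathfrak{so}_B(V)\otimes C\ell(V)$ if and only if, for some orthonormal basis of $V$, $(c,d)=(a,b)+\bigl(t+s\Gamma^*,\,t-(-1)^n s\Gamma^*\bigr)$ with $t,s\in\mathbb C$, where $(a,b)$ is a quadratic Clifford pair associated to the same $B$ of the following form. 1. If $B=\lambda\mathbf 1$: a pair of scalars $(\alpha,\beta)$ or a pair of pseudo-scalars $(\alpha\Gamma^*,\beta\Gamma^*)$, $\alpha,\beta\in\mathbb C$. 2. If $B$ has exactly two eigenvalues: a monomial pair $(\alpha\Gamma_I,\beta\Gamma_I)$, or a pseudo-monomial pair, i.e. $n$ is even, $\emptyset\neq I\neq\{1,\dots,n\}$, and either $\hat I$ is even, $a=(\alpha+\beta\Gamma^*)\Gamma_I$ and $b=\pm a$, or $\hat I$ is odd, $a=\alpha(\cos\phi\,e^{i\psi}+\sin\phi\,\Gamma^*)\Gamma_I$ and $b=\beta(\cos\phi\,e^{i\psi}-\sin\phi\,\Gamma^*)\Gamma_I$, with $\alpha,\beta\in\mathbb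 C$, $\phi,\psi\in\mathbb R$. 3. If $B$ has more than two eigenvalues: a generalized monomial pair, i.e. there is a partition of $\{1,\dots,n\}$ into more than two non-empty sets $I_\alpha$, and complex numbers $c_\alpha,\hat c_\alpha$, such that either - $a=\sum_\alpha c_\alpha\Gamma_{I_\alpha}$, $b=\sum_\alpha(-1)^{\hat I_\alpha}c_\alpha\Gamma_{I_\alpha}$ and at most one $\hat I_\alpha$ is odd (hence none if $n$ is even); or - $a=\sum_\alpha c_\alpha\Gamma_{I_\alpha}+\Gamma^*\sum_\alpha\hat c_\alpha\Gamma_{I_\alpha}$, $b=\sum_\alpha(-1)^{\hat I_\alpha}c_\alpha\Gamma_{I_\alpha}-\Gamma^*\sum_\alpha(-1)^{\hat I_\alpha}\hat c_\alpha\Gamma_{I_\alpha}$, and either all $\hat I_\alpha$ are even and $c_\alpha\hat c_\alpha=0$ for all $\alpha$, or exactly two of them, $\hat I_{\alpha_0},\hat I_{\alpha_1}$, are odd, $c_{\alpha_0}c_{\alpha_1}=\hat c_{\alpha_0}\hat c_{\alpha_1}$, and $\hat c_\alpha=0$ for all other $\alpha$ (so $n$ is even). Moreover, in this case, if $\Omega_{c,d}\in\mathfrak{so}_B(V)\otimes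 C\ell(V)$, the data can be chosen such that the $e_i$ with $i\in I_\alpha$ span the eigenspaces of $B$, with distinct eigenvalues for distinct $\alpha$. If $\Omega_{c,d}\in\mathfrak{so}_B(V)\otimes C\ell(V)$, then all eigenvalues of $B$ have even multiplicity, with at most two exceptions. -/

import Mathlib

open scoped TensorProduct

noncomputable section

namespace CliffordPair

/-- The quadratic form `v ↦ -⟪v, v⟫` of a Euclidean space, so that the Clifford relation is
`v * w + w * v = -2 ⟪v, w⟫`. -/
def negNormForm (V : Type*) [NormedAddCommGroup V] [InnerProductSpace ℝ V] :
    QuadraticForm ℝ V :=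
  -(LinearMap.BilinMap.toQuadraticMap (innerₗ V))

/-- The complex Clifford algebra of a Euclidean space. -/
abbrev ComplexClifford (V : Type*) [NormedAddCommGroup V] [InnerProductSpace ℝ V] : Type _ :=
  ℂ ⊗[ℝ] CliffordAlgebra (negNormForm V)

/-- The action of the complex Clifford algebra on a Clifford module `S`. For simple `S` it is used
to read elements of the Clifford algebra as endomorphisms of `S`. -/
def rep (V S : Type*) [NormedAddCommGroup V] [InnerProductSpace ℝ V] [AddCommGroup S]
    [Module ℂ S] [Module (ComplexClifford V) S] [IsScalarTower ℂ (ComplexClifford V) S] :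
    ComplexClifford V →ₐ[ℂ] Module.End ℂ S :=
  Algebra.lsmul ℂ ℂ S

/-- The gamma matrices: the endomorphism of `S` given by a vector. -/
def gamma (V S : Type*) [NormedAddCommGroup V] [InnerProductSpace ℝ V] [AddCommGroup S]
    [Module ℂ S] [Module (ComplexClifford V) S] [IsScalarTower ℂ (ComplexClifford V) S]
    (v : V) : Module.End ℂ S :=
  rep V S (1 ⊗ₜ[ℝ] CliffordAlgebra.ι (negNormForm V) v)

section Algebra

/- In this section `A` is a complex algebra and `G : V → A` the map that reads a vector in it. -/

variable {V A : Type*} [NormedAddCommGroup V] [InnerProductSpace ℝ V] [Ring A] [Algebra ℂ A]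

/-- `s_{a,b}(x) = a x - x b`. -/
def sMap (a b x : A) : A := a * x - x * b

/-- `q_{a,b}(x) = a² x + x b² - 2 a x b`. -/
def qMap (a b x : A) : A := a ^ 2 * x + x * b ^ 2 - 2 * (a * x * b)

/-- `(a, b)` is a quadratic Clifford pair associated to `B`: the map `q_{a,b}` sends `V` to `V`,
and its restriction to `V` is symmetric and equal to `B`. -/
def IsPairFor (G : V → A) (B : V →ₗ[ℝ] V) (a b : A) : Prop :=
  B.IsSymmetric ∧ ∀ v, qMap a b (G v) = G (B v)

/-- The skew-symmetric endomorphisms of `V` that commute with `B`. -/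
def soB (B : V →ₗ[ℝ] V) : Set (V →ₗ[ℝ] V) :=
  {D | (∀ v w, inner ℝ (D v) w = -inner ℝ v (D w)) ∧ D ∘ₗ B = B ∘ₗ D}

/-- `Ω_{c,d}(v,w) = s_{d,c}(v) w + w s_{c,d}(v)`. -/
def Omega (G : V → A) (c d : A) (v w : V) : A :=
  sMap d c (G v) * G w + G w * sMap c d (G v)

/-- `so_B(V) ⊗ A` as a space of `A`-valued bilinear maps: it is spanned by the tensors
`D ⊗ x : (v, w) ↦ ⟪D v, w⟫ x` with `D` in `so_B(V)` and `x` in `A`. -/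
def soBTensor (A : Type*) [Ring A] [Algebra ℂ A] (B : V →ₗ[ℝ] V) : Submodule ℂ (V → V → A) :=
  Submodule.span ℂ {T | ∃ D ∈ soB B, ∃ x : A, T = fun v w => ((inner ℝ (D v) w : ℝ) : ℂ) • x}

/-- The element of degree two in the Clifford algebra given by a skew-symmetric endomorphism `D`;
its commutator with a vector `v` is `D v`. -/
def spinElement [FiniteDimensional ℝ V] (G : V → A) (D : V →ₗ[ℝ] V) : A :=
  (1 / 4 : ℂ) • ∑ i, G (stdOrthonormalBasis ℝ V i) * G (D (stdOrthonormalBasis ℝ V i))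

/-- Invariance of an element of the Clifford algebra with respect to `so_B(V)`. -/
def IsInvariant [FiniteDimensional ℝ V] (G : V → A) (B : V →ₗ[ℝ] V) (c : A) : Prop :=
  ∀ D ∈ soB B, spinElement G D * c = c * spinElement G D

variable {n : ℕ}

/-- `Γ_I`, the product of the `Γ_i`, `i ∈ I`, in increasing order, for an orthonormal basis. -/
def gammaProd (G : V → A) (e : OrthonormalBasis (Fin n) ℝ V) (I : Finset (Fin n)) : A :=
  ((I.sort (· ≤ ·)).map fun i => G (e i)).prod

/-- The complex volume element `Γ^* = i^[(n+1)/2] Γ_{1…n}`. -/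
def gammaStar (G : V → A) (e : OrthonormalBasis (Fin n) ℝ V) : A :=
  Complex.I ^ ((n + 1) / 2) • gammaProd G e Finset.univ

/-- `(c, d)` and `(a, b)` differ by a pair `(t + s Γ^*, t - (-1)^n s Γ^*)`. These are the pairs
`(x, y)` with `s_{x,y} = 0` on `V`. -/
def EqUpToTrivial (G : V → A) (e : OrthonormalBasis (Fin n) ℝ V) (c d a b : A) : Prop :=
  ∃ t s : ℂ, c = a + (t • 1 + s • gammaStar G e) ∧
    d = b + (t • 1 - ((-1) ^ n * s) • gammaStar G e)

/-- A pair of scalars. -/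
def IsScalarPair (a b : A) : Prop :=
  ∃ α β : ℂ, a = α • 1 ∧ b = β • 1

/-- A pair of pseudo scalars. -/
def IsPseudoScalarPair (G : V → A) (e : OrthonormalBasis (Fin n) ℝ V) (a b : A) : Prop :=
  ∃ α β : ℂ, a = α • gammaStar G e ∧ b = β • gammaStar G e

/-- The shape of a monomial pair with index set `I`. -/
def IsMonomial (G : V → A) (e : OrthonormalBasis (Fin n) ℝ V) (I : Finset (Fin n))
    (a b : A) : Prop :=
  ∃ α β : ℂ, a = α • gammaProd G e I ∧ b = β • gammaProd G e I

/-- The shape of a pseudo-monomial pair with index set `I`, of even or of odd type. -/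
def IsPseudoMonomial (G : V → A) (e : OrthonormalBasis (Fin n) ℝ V) (I : Finset (Fin n))
    (a b : A) : Prop :=
  Even n ∧ I.Nonempty ∧ I ≠ Finset.univ ∧
    ((Even I.card ∧ ∃ α β : ℂ,
        a = (α • 1 + β • gammaStar G e) * gammaProd G e I ∧ (b = a ∨ b = -a)) ∨
      (Odd I.card ∧ ∃ (α β : ℂ) (φ ψ : ℝ),
        a = α • ((((Real.cos φ : ℂ) * Complex.exp (Complex.I * ψ)) • 1
              + (Real.sin φ : ℂ) • gammaStar G e) * gammaProd G e I) ∧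
        b = β • ((((Real.cos φ : ℂ) * Complex.exp (Complex.I * ψ)) • 1
              - (Real.sin φ : ℂ) • gammaStar G e) * gammaProd G e I)))

variable {m : ℕ}

/-- A decomposition of the index set into non-empty disjoint blocks. -/
def IsBlockDecomposition (I : Fin m → Finset (Fin n)) : Prop :=
  (∀ α, (I α).Nonempty) ∧ (∀ α β, α ≠ β → Disjoint (I α) (I β)) ∧ ∀ i, ∃ α, i ∈ I α

/-- The shape of a generalized monomial pair without pseudo-monomial summands:
`a = ∑ x_α Γ_{I_α}` and `b = ∑ (-1)^|I_α| x_α Γ_{I_α}` with at most one odd block (so with none in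
even dimension). -/
def IsGeneralizedMonomialPlain (G : V → A) (e : OrthonormalBasis (Fin n) ℝ V)
    (I : Fin m → Finset (Fin n)) (a b : A) : Prop :=
  ∃ x : Fin m → ℂ,
    a = ∑ α, x α • gammaProd G e (I α) ∧
    b = ∑ α, ((-1) ^ (I α).card * x α) • gammaProd G e (I α) ∧
    ∀ α β, Odd (I α).card → Odd (I β).card → α = β

/-- The shape of a generalized monomial pair with pseudo-monomial summands:
`a = ∑ x_α Γ_{I_α} + Γ^* ∑ y_α Γ_{I_α}` and
`b = ∑ (-1)^|I_α| x_α Γ_{I_α} - Γ^* ∑ (-1)^|I_α| y_α Γ_{I_α}`, where either all blocks are even and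
`x_α y_α = 0` for each, or exactly two blocks `α₀`, `α₁` are odd with
`x_{α₀} x_{α₁} = y_{α₀} y_{α₁}` and `y_α = 0` for the others. Here the dimension is even. -/
def IsGeneralizedMonomialPseudo (G : V → A) (e : OrthonormalBasis (Fin n) ℝ V)
    (I : Fin m → Finset (Fin n)) (a b : A) : Prop :=
  ∃ x y : Fin m → ℂ,
    a = ∑ α, x α • gammaProd G e (I α) + gammaStar G e * ∑ α, y α • gammaProd G e (I α) ∧
    b = ∑ α, ((-1) ^ (I α).card * x α) • gammaProd G e (I α)
        - gammaStar G e * ∑ α, ((-1) ^ (I α).card * y α) • gammaProd G e (I α) ∧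
    ((∀ α, Even (I α).card ∧ x α * y α = 0) ∨
      ∃ α₀ α₁, α₀ ≠ α₁ ∧ Odd (I α₀).card ∧ Odd (I α₁).card ∧ x α₀ * x α₁ = y α₀ * y α₁ ∧
        ∀ α, α ≠ α₀ → α ≠ α₁ → Even (I α).card ∧ y α = 0)

/-- The shape of a generalized monomial pair with blocks `I_α`; there are more than two of them. -/
def IsGeneralizedMonomial (G : V → A) (e : OrthonormalBasis (Fin n) ℝ V)
    (I : Fin m → Finset (Fin n)) (a b : A) : Prop :=
  2 < m ∧ IsBlockDecomposition I ∧
    (IsGeneralizedMonomialPlain G e I a b ∨ IsGeneralizedMonomialPseudo G e I a b)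

end Algebra

end CliffordPair

end

noncomputable section

/-! ### Gamma systems: conjugation by generators, blades and the volume element -/

namespace CliffordPair

variable {A : Type*} [Ring A] [Algebra ℂ A] {n : ℕ}

/-! Take an orthonormal eigenbasis `e` of `B` and let `g i` be the action of `e i`. Everything is
read off from the conjugations `twist (g i)`. One has `s_{c,d}(g i) = 2 X_i (g i)` with `X_i = half
g c d i`, and in terms of `X_i` both conditions become algebraic: `q_{c,d}(g i) = (4 X_i² + 2 [c,
X_i]) g i` (`qMap_gen`), while for `i ≠ j` the vanishing of `Ω(e i, e j)` means that conjugating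
`X_i` by `g i` and by `g j` gives opposite results (`omega_gen_eq_zero_iff`). As `Ω` is
antisymmetric, it lies in `so_B(V) ⊗ A` iff it vanishes on basis vectors with different eigenvalues
(`omega_mem_iff`).

Invariance under `so_B(V)` makes all conjugates of `c`, and of `d`, agree within an eigenspace. With
the condition on `Ω`, the conjugates of `X_i` then agree on the block of `i`, and take the opposite
value outside it. By Schur's lemma an element with all conjugates equal is a combination of `1` and
`Γ^*`, so one with this sign pattern is `(x + y Γ^*) Γ_I` (`exists_eq_mono`). The sum of one such
`X_α` per block recovers `c`, and a signed version recovers `d`, up to a trivial pair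
(`exists_blockSum`).

The quadratic relation is then split by conjugating with `g i * g j` for `i`, `j` in different
blocks, which flips exactly two of the `X_α`. With more than two blocks this shows that the `X_α`
commute and that `4 X_α²` is the eigenvalue; comparing coefficients and using that eigenvalues are
distinct gives the parity conditions (`odd_blocks_classification`). With two blocks, these are
complementary, both elements are pseudo-monomials over one index set, and the `Γ^*`-component of `q`
selects the shapes. With one block the condition on `Ω` is empty.

Conversely, for the shapes with two or more blocks each `q(g i)` is a multiple of `g i`, so the
given basis diagonalizes `B`. Vectors with different eigenvalues lie in different blocks, and there
the sign pattern makes `Ω` vanish. -/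

/-- Anticommuting square roots of `-1` in a complex algebra with only the scalars as their
centralizer. -/
structure IsGammaSystem (g : Fin n → A) : Prop where
  sq : ∀ i, g i * g i = -1
  anti : ∀ i j, i ≠ j → g i * g j = -(g j * g i)
  central : ∀ x, (∀ i, g i * x = x * g i) → ∃ z : ℂ, x = z • 1

/-- Conjugation `x ↦ u x u⁻¹` by a square root `u` of `-1`. -/
def twist (u : A) : A →ₗ[ℂ] A where
  toFun x := -(u * x * u)
  map_add' x y := by noncomm_ring
  map_smul' z x := by simp

theorem twist_apply (u x : A) : twist u x = -(u * x * u) := rfl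

/-- The product of the `g i`, `i ∈ I`, in increasing order. -/
def blade (g : Fin n → A) (I : Finset (Fin n)) : A := ((I.sort (· ≤ ·)).map g).prod

/-- The normalized product of all `g i`. -/
def bladeStar (g : Fin n → A) : A := Complex.I ^ ((n + 1) / 2) • blade g Finset.univ

theorem twist_mul {u : A} (hu : u * u = -1) (x y : A) :
    twist u (x * y) = twist u x * twist u y := by
  have : twist u x * twist u y = u * x * (u * u) * (y * u) := by
    simp only [twist_apply]; noncomm_ring
  rw [this, hu, twist_apply]; noncomm_ring

theorem twist_one {u : A} (hu : u * u = -1) : twist u 1 = 1 := by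
  simp [twist_apply, hu]

theorem twist_twist {u : A} (hu : u * u = -1) (x : A) : twist u (twist u x) = x := by
  have : twist u (twist u x) = (u * u) * x * (u * u) := by
    simp only [twist_apply]; noncomm_ring
  rw [this, hu]; noncomm_ring

theorem twist_mul_self {u : A} (hu : u * u = -1) (x : A) : twist u x * u = u * x := by
  have : twist u x * u = -(u * x * (u * u)) := by simp only [twist_apply]; noncomm_ring
  rw [this, hu]; noncomm_ring

theorem twist_eq_smul_iff {u : A} (hu : u * u = -1) (x : A) (z : ℂ) :
    twist u x = z • x ↔ u * x = z • (x * u) := by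
  constructor
  · intro h
    rw [← twist_mul_self hu, h, smul_mul_assoc]
  · intro h
    rw [twist_apply, h, smul_mul_assoc, mul_assoc, hu]; simp

namespace IsGammaSystem

variable {g : Fin n → A}

theorem twist_gen (hg : IsGammaSystem g) (i j : Fin n) :
    twist (g i) (g j) = (if i = j then (1 : ℂ) else -1) • g j := by
  split_ifs with h
  · subst h; simp [twist_apply, hg.sq]
  · rw [twist_apply, hg.anti i j h, neg_mul, mul_assoc, hg.sq]; simp

theorem twist_list (hg : IsGammaSystem g) (i : Fin n) (l : List (Fin n)) (hl : l.Nodup) :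
    twist (g i) (l.map g).prod =
      (if i ∈ l then -(-1 : ℂ) ^ l.length else (-1) ^ l.length) • (l.map g).prod := by
  induction l with
  | nil => simp [twist_one (hg.sq i)]
  | cons a l ih =>
    rw [List.nodup_cons] at hl
    rw [List.map_cons, List.prod_cons, twist_mul (hg.sq i), ih hl.2, hg.twist_gen,
      smul_mul_smul_comm]
    congr 1
    by_cases h : i = a
    · subst h; simp [hl.1, pow_succ]
    · simp only [h, if_false, List.mem_cons, false_or, List.length_cons, pow_succ]
      split_ifs <;> ring

theorem twist_blade (hg : IsGammaSystem g) (i : Fin n) (I : Finset (Fin n)) :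
    twist (g i) (blade g I) =
      (if i ∈ I then -(-1 : ℂ) ^ I.card else (-1) ^ I.card) • blade g I := by
  rw [blade, hg.twist_list i _ (I.sort_nodup _)]
  simp

theorem twist_blade_of_mem (hg : IsGammaSystem g) {i : Fin n} {I : Finset (Fin n)} (h : i ∈ I) :
    twist (g i) (blade g I) = (-(-1 : ℂ) ^ I.card) • blade g I := by
  rw [hg.twist_blade, if_pos h]

theorem twist_blade_of_notMem (hg : IsGammaSystem g) {i : Fin n} {I : Finset (Fin n)}
    (h : i ∉ I) : twist (g i) (blade g I) = ((-1 : ℂ) ^ I.card) • blade g I := by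
  rw [hg.twist_blade, if_neg h]

theorem list_sq (hg : IsGammaSystem g) (l : List (Fin n)) (hl : l.Nodup) :
    (l.map g).prod * (l.map g).prod = ((-1 : ℂ) ^ (l.length * (l.length + 1) / 2)) • 1 := by
  induction l with
  | nil => simp
  | cons a l ih =>
    rw [List.nodup_cons] at hl
    have h := hg.twist_list a l hl.2
    rw [if_neg hl.1, twist_eq_smul_iff (hg.sq a)] at h
    have e : ((a :: l).map g).prod * ((a :: l).map g).prod
        = (g a * (l.map g).prod) * (g a * (l.map g).prod) := by simp
    have e2 : ((l.map g).prod * g a) * (g a * (l.map g).prod)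
        = (l.map g).prod * (g a * g a) * (l.map g).prod := by simp only [mul_assoc]
    rw [e]
    nth_rewrite 1 [h]
    rw [smul_mul_assoc, e2, hg.sq, mul_neg, mul_one, neg_mul, ih hl.2, ← neg_smul, smul_smul,
      List.length_cons, show (l.length + 1) * (l.length + 1 + 1) / 2
        = l.length * (l.length + 1) / 2 + (l.length + 1) by
          rw [show (l.length + 1) * (l.length + 1 + 1)
            = l.length * (l.length + 1) + (l.length + 1) * 2 by ring]
          exact Nat.add_mul_div_right _ _ (by norm_num), pow_add, pow_succ]
    congr 1; ring

/-- Each generator in `J` passes `x` at the cost of a factor `z`, and a blade consists of `J.card`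
of them. -/
theorem comm_blade (hg : IsGammaSystem g) (J : Finset (Fin n)) (x : A) (z : ℂ)
    (h : ∀ j ∈ J, twist (g j) x = z • x) :
    blade g J * x = z ^ J.card • (x * blade g J) := by
  have key : ∀ l : List (Fin n), (∀ j ∈ l, j ∈ J) →
      (l.map g).prod * x = z ^ l.length • (x * (l.map g).prod) := by
    intro l
    induction l with
    | nil => simp
    | cons a l ih =>
      intro hl
      have ha := h a (hl a (by simp))
      rw [twist_eq_smul_iff (hg.sq a)] at ha
      rw [List.map_cons, List.prod_cons, mul_assoc, ih (fun j hj => hl j (by simp [hj])),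
        mul_smul_comm, ← mul_assoc, ha, List.length_cons, pow_succ, smul_mul_assoc, smul_smul,
        mul_assoc]
  simpa [blade] using key (J.sort (· ≤ ·)) (by simp)

theorem blade_sq (hg : IsGammaSystem g) (I : Finset (Fin n)) :
    blade g I * blade g I = ((-1 : ℂ) ^ (I.card * (I.card + 1) / 2)) • 1 := by
  simpa [blade] using hg.list_sq (I.sort (· ≤ ·)) (I.sort_nodup _)

/-- The power of `i` in the normalization squares to the sign of the square of the full blade. -/
theorem bladeStar_sq (hg : IsGammaSystem g) : bladeStar g * bladeStar g = 1 := by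
  rw [bladeStar, smul_mul_smul_comm, hg.blade_sq, smul_smul, ← pow_add, ← two_mul, pow_mul,
    Complex.I_sq, ← pow_add, Finset.card_univ, Fintype.card_fin]
  have : Even ((n + 1) / 2 + n * (n + 1) / 2) := by
    obtain ⟨k, rfl | rfl⟩ := n.even_or_odd'
    · rw [show 2 * k * (2 * k + 1) = (k * (2 * k + 1)) * 2 by ring, Nat.mul_div_cancel _ two_pos,
        show (2 * k + 1) / 2 = k by omega]
      exact ⟨k * (k + 1), by ring⟩
    · rw [show (2 * k + 1) * (2 * k + 1 + 1) = ((2 * k + 1) * (k + 1)) * 2 by ring,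
        Nat.mul_div_cancel _ two_pos, show (2 * k + 1 + 1) / 2 = k + 1 by omega]
      exact ⟨(k + 1) * (k + 1), by ring⟩
  rw [this.neg_one_pow, one_smul]

theorem twist_bladeStar (hg : IsGammaSystem g) (i : Fin n) :
    twist (g i) (bladeStar g) = (-(-1 : ℂ) ^ n) • bladeStar g := by
  rw [bladeStar, map_smul, hg.twist_blade_of_mem (Finset.mem_univ i), smul_comm]
  simp

theorem twist_bladeStar_of_even (hg : IsGammaSystem g) (hn : Even n) (i : Fin n) :
    twist (g i) (bladeStar g) = -bladeStar g := by
  rw [hg.twist_bladeStar, hn.neg_one_pow, neg_one_smul]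

theorem twist_bladeStar_of_odd (hg : IsGammaSystem g) (hn : Odd n) (i : Fin n) :
    twist (g i) (bladeStar g) = bladeStar g := by
  rw [hg.twist_bladeStar, hn.neg_one_pow, neg_neg, one_smul]

theorem twist_smul_one (hg : IsGammaSystem g) (i : Fin n) (z : ℂ) :
    twist (g i) (z • (1 : A)) = z • 1 := by
  rw [map_smul, twist_one (hg.sq i)]

theorem exists_smul_one (hg : IsGammaSystem g) (x : A) (h : ∀ i, twist (g i) x = x) :
    ∃ z : ℂ, x = z • 1 := by
  refine hg.central x fun i => ?_
  have := (twist_eq_smul_iff (hg.sq i) x 1).1 (by rw [h, one_smul])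
  simpa using this

theorem blade_mul_bladeStar (hg : IsGammaSystem g) (hn : Even n) (J : Finset (Fin n)) :
    blade g J * bladeStar g = ((-1 : ℂ) ^ J.card) • (bladeStar g * blade g J) :=
  hg.comm_blade J _ _ fun j _ => by rw [hg.twist_bladeStar_of_even hn, neg_one_smul]

theorem blade_mul_blade (hg : IsGammaSystem g) {I J : Finset (Fin n)} (h : Disjoint I J) :
    blade g J * blade g I = ((-1 : ℂ) ^ (I.card * J.card)) • (blade g I * blade g J) := by
  rw [pow_mul]
  exact hg.comm_blade J _ _ fun j hj =>
    hg.twist_blade_of_notMem (Finset.disjoint_right.1 h hj)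

/-- In odd dimension the volume element is central. From here on its coefficient is normalized to
zero for odd `n`, which is the purpose of the recurring hypotheses `Odd n → y = 0`. -/
theorem bladeStar_eq_smul_one (hg : IsGammaSystem g) (hn : Odd n) :
    ∃ z : ℂ, bladeStar g = z • 1 :=
  hg.exists_smul_one _ (hg.twist_bladeStar_of_odd hn)

/-- An element whose conjugates by the generators agree is a combination of `1` and the volume
element. -/
theorem exists_add_bladeStar (hg : IsGammaSystem g) (x : A)
    (h : ∀ i j, twist (g i) x = twist (g j) x) :
    ∃ z w : ℂ, x = z • 1 + w • bladeStar g ∧ (Odd n → w = 0) := by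
  rcases Nat.eq_zero_or_pos n with hn | hn
  · subst hn
    obtain ⟨z, hz⟩ := hg.exists_smul_one x fun i => i.elim0
    exact ⟨z, 0, by simp [hz], fun _ => rfl⟩
  let o : Fin n := ⟨0, hn⟩
  -- The two eigenparts of `x` under conjugation by one generator are eigenparts for every
  -- generator, because all conjugates of `x` agree.
  have hp : ∀ i, twist (g i) (x + twist (g o) x) = x + twist (g o) x := fun i => by
    rw [map_add, ← h i o, twist_twist (hg.sq i), add_comm]
  have hm : ∀ i, twist (g i) (x - twist (g o) x) = -(x - twist (g o) x) := fun i => by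
    rw [map_sub, ← h i o, twist_twist (hg.sq i)]; abel
  obtain ⟨z, hz⟩ := hg.exists_smul_one _ hp
  have hx : x = (2⁻¹ : ℂ) • (x + twist (g o) x) + (2⁻¹ : ℂ) • (x - twist (g o) x) := by
    module
  rcases n.even_or_odd with he | ho
  -- For even `n` the volume element anticommutes with every generator, so multiplying by it makes
  -- the odd part invariant.
  · obtain ⟨w, hw⟩ := hg.exists_smul_one ((x - twist (g o) x) * bladeStar g) fun i => by
      rw [twist_mul (hg.sq i), hm, hg.twist_bladeStar_of_even he, neg_mul_neg]
    have hw' : x - twist (g o) x = w • bladeStar g := by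
      have := congrArg (· * bladeStar g) hw
      simpa [mul_assoc, hg.bladeStar_sq] using this
    refine ⟨2⁻¹ * z, 2⁻¹ * w, ?_, fun ho => absurd he (Nat.not_even_iff_odd.2 ho)⟩
    rw [hx, hz, hw', smul_smul, smul_smul]
  · refine ⟨2⁻¹ * z, 0, ?_, fun _ => rfl⟩
    -- For odd `n` the odd part anticommutes with the volume element, which is a nonzero scalar;
    -- hence it vanishes.
    have hc : bladeStar g * (x - twist (g o) x) = -((x - twist (g o) x) * bladeStar g) := by
      rw [bladeStar, smul_mul_assoc, hg.comm_blade Finset.univ _ (-1) fun j _ => by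
        rw [hm, neg_one_smul], Finset.card_univ, Fintype.card_fin, ho.neg_one_pow, mul_smul_comm]
      module
    obtain ⟨s, hs⟩ := hg.bladeStar_eq_smul_one ho
    have hs2 := hg.bladeStar_sq
    have h0 : (2 : ℂ) • (bladeStar g * (x - twist (g o) x)) = 0 := by
      have e : bladeStar g * (x - twist (g o) x) = (x - twist (g o) x) * bladeStar g := by
        rw [hs]; simp
      rw [two_smul]; nth_rewrite 2 [hc]; rw [e]; abel
    have h1 : bladeStar g * (x - twist (g o) x) = 0 := by simpa using h0
    have h2 : x - twist (g o) x = 0 := by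
      have := congrArg (bladeStar g * ·) h1
      simpa [← mul_assoc, hs2] using this
    rw [hx, hz, h2, smul_smul]; simp

/-- Conjugation by a generator separates `1` from `Γ^*`. The index `i` excludes `n = 0`, where both
coincide. -/
theorem smul_one_add_bladeStar_eq_zero [Nontrivial A] (hg : IsGammaSystem g) (hn : Even n)
    (i : Fin n) {z w : ℂ} (h : z • (1 : A) + w • bladeStar g = 0) : z = 0 ∧ w = 0 := by
  have h' := congrArg (twist (g i)) h
  rw [map_add, hg.twist_smul_one, map_smul, hg.twist_bladeStar_of_even hn, map_zero] at h'
  have h1 : (2 * z) • (1 : A) = 0 := by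
    have := congrArg₂ (· + ·) h h'
    simp only [add_zero] at this
    rw [← this]; module
  have hz : z = 0 := by simpa using h1
  refine ⟨hz, ?_⟩
  rw [hz, zero_smul, zero_add] at h
  have := congrArg (· * bladeStar g) h
  simpa [hg.bladeStar_sq] using this

theorem mul_blade_eq_zero (hg : IsGammaSystem g) {x : A} {I : Finset (Fin n)}
    (h : x * blade g I = 0) : x = 0 := by
  have := congrArg (· * blade g I) h
  simpa [mul_assoc, hg.blade_sq] using this

end IsGammaSystem

end CliffordPair

/-! ### Pseudo-monomials; the maps `q` and `Ω` on generators -/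

namespace CliffordPair

variable {A : Type*} [Ring A] [Algebra ℂ A] {n m : ℕ}

/-- A combination of `1` and the volume element. -/
def bladeLin (g : Fin n → A) (x y : ℂ) : A := x • 1 + y • bladeStar g

/-- A pseudo-monomial `(x + y Γ^*) Γ_I`. -/
def mono (g : Fin n → A) (I : Finset (Fin n)) (x y : ℂ) : A := bladeLin g x y * blade g I

/-- The factor `x` of `s_{c,d}(g i) = 2 x (g i)`. -/
def half (g : Fin n → A) (c d : A) (i : Fin n) : A := (2⁻¹ : ℂ) • (c - twist (g i) d)

namespace IsGammaSystem

variable {g : Fin n → A}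

theorem bladeLin_mul (hg : IsGammaSystem g) (x y x' y' : ℂ) :
    bladeLin g x y * bladeLin g x' y' = bladeLin g (x * x' + y * y') (x * y' + y * x') := by
  simp only [bladeLin, mul_add, add_mul, smul_mul_smul_comm, one_mul, mul_one, hg.bladeStar_sq]
  module

theorem twist_bladeLin (hg : IsGammaSystem g) (i : Fin n) {x y : ℂ} (hy : Odd n → y = 0) :
    twist (g i) (bladeLin g x y) = bladeLin g x (-y) := by
  rcases n.even_or_odd with he | ho
  · rw [bladeLin, map_add, hg.twist_smul_one, map_smul, hg.twist_bladeStar_of_even he, bladeLin]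
    simp
  · rw [hy ho]; simp [bladeLin, twist_one (hg.sq i)]

theorem bladeLin_eq_zero [Nontrivial A] (hg : IsGammaSystem g) (i : Fin n) {x y : ℂ}
    (hy : Odd n → y = 0) (h : bladeLin g x y = 0) : x = 0 ∧ y = 0 := by
  rcases n.even_or_odd with he | ho
  · exact hg.smul_one_add_bladeStar_eq_zero he i h
  · rw [hy ho] at h
    exact ⟨by simpa [bladeLin] using h, hy ho⟩

theorem blade_mul_bladeLin (hg : IsGammaSystem g) (I : Finset (Fin n)) {x y : ℂ}
    (hy : Odd n → y = 0) :
    blade g I * bladeLin g x y = bladeLin g x ((-1) ^ I.card * y) * blade g I := by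
  rcases n.even_or_odd with he | ho
  · simp only [bladeLin, mul_add, add_mul, mul_smul_comm, smul_mul_assoc,
      hg.blade_mul_bladeStar he, smul_smul, mul_one, one_mul]
    rw [mul_comm y]
  · rw [hy ho]; simp [bladeLin]

theorem mono_mul_mono (hg : IsGammaSystem g) (I J : Finset (Fin n)) {x y x' y' : ℂ}
    (hy' : Odd n → y' = 0) :
    mono g I x y * mono g J x' y' =
      bladeLin g (x * x' + (-1) ^ I.card * (y * y')) ((-1) ^ I.card * (x * y') + y * x') *
        (blade g I * blade g J) := by
  have : mono g I x y * mono g J x' y' =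
      bladeLin g x y * (blade g I * bladeLin g x' y') * blade g J := by
    simp only [mono, mul_assoc]
  rw [this, hg.blade_mul_bladeLin I hy', ← mul_assoc, hg.bladeLin_mul]
  simp only [mul_assoc]
  congr 2 <;> ring

theorem mono_mul_mono_self (hg : IsGammaSystem g) (I : Finset (Fin n)) {x y x' y' : ℂ}
    (hy' : Odd n → y' = 0) :
    mono g I x y * mono g I x' y' =
      ((-1 : ℂ) ^ (I.card * (I.card + 1) / 2)) •
        bladeLin g (x * x' + (-1) ^ I.card * (y * y')) ((-1) ^ I.card * (x * y') + y * x') := by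
  rw [hg.mono_mul_mono I I hy', hg.blade_sq, mul_smul_comm, mul_one]

theorem twist_mono_of_mem (hg : IsGammaSystem g) {i : Fin n} {I : Finset (Fin n)} (hi : i ∈ I)
    {x y : ℂ} (hy : Odd n → y = 0) :
    twist (g i) (mono g I x y) = (-(-1 : ℂ) ^ I.card) • mono g I x (-y) := by
  rw [mono, twist_mul (hg.sq i), hg.twist_blade_of_mem hi, hg.twist_bladeLin i hy,
    mul_smul_comm, mono]

theorem twist_mono_of_notMem (hg : IsGammaSystem g) {i : Fin n} {I : Finset (Fin n)}
    (hi : i ∉ I) {x y : ℂ} (hy : Odd n → y = 0) :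
    twist (g i) (mono g I x y) = ((-1 : ℂ) ^ I.card) • mono g I x (-y) := by
  rw [mono, twist_mul (hg.sq i), hg.twist_blade_of_notMem hi, hg.twist_bladeLin i hy,
    mul_smul_comm, mono]

/-- Pseudo-monomials are characterized by their conjugates. -/
theorem exists_eq_mono (hg : IsGammaSystem g) (I : Finset (Fin n)) (x : A)
    (h : ∀ i j, (i ∈ I ↔ j ∈ I) → twist (g i) x = twist (g j) x)
    (h' : ∀ i j, i ∈ I → j ∉ I → twist (g j) x = -twist (g i) x) :
    ∃ u v : ℂ, x = mono g I u v ∧ (Odd n → v = 0) := by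
  -- The blade `Γ_I` has the same sign pattern as `x`, so all conjugates of `x Γ_I` agree and only
  -- `1` and `Γ^*` remain.
  have key : ∀ i j, i ∈ I → j ∉ I →
      twist (g i) (x * blade g I) = twist (g j) (x * blade g I) := fun i j hi hj => by
    rw [twist_mul (hg.sq i), twist_mul (hg.sq j), hg.twist_blade_of_mem hi,
      hg.twist_blade_of_notMem hj, h' i j hi hj]
    simp
  obtain ⟨z, w, hzw, hw⟩ := hg.exists_add_bladeStar (x * blade g I) fun i j => by
    by_cases hi : i ∈ I <;> by_cases hj : j ∈ I
    · rw [twist_mul (hg.sq i), twist_mul (hg.sq j), hg.twist_blade_of_mem hi,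
        hg.twist_blade_of_mem hj, h i j (by simp [hi, hj])]
    · exact key i j hi hj
    · exact (key j i hj hi).symm
    · rw [twist_mul (hg.sq i), twist_mul (hg.sq j), hg.twist_blade_of_notMem hi,
        hg.twist_blade_of_notMem hj, h i j (by simp [hi, hj])]
  -- The sign of `Γ_I²`, which is needed to cancel `Γ_I` again.
  set ε : ℂ := (-1 : ℂ) ^ (I.card * (I.card + 1) / 2) with hε
  have hε2 : ε * ε = 1 := by rw [hε, ← pow_add, ← two_mul, pow_mul]; simp
  refine ⟨ε * z, ε * w, ?_, fun ho => by rw [hw ho, mul_zero]⟩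
  have h1 : ε • x = bladeLin g z w * blade g I := by
    rw [bladeLin, ← hzw, mul_assoc, hg.blade_sq, mul_smul_comm, mul_one]
  have h2 : x = ε • (ε • x) := by rw [smul_smul, hε2, one_smul]
  rw [h2, h1, mono, bladeLin, bladeLin, ← smul_mul_assoc, smul_add, smul_smul, smul_smul]

/-- Moving `g i` to the right replaces `d` by its conjugate `c - 2 X`; then `c² + (c - 2X)² - 2c(c -
2X) = 4X² + 2[c, X]`. -/
theorem qMap_gen (hg : IsGammaSystem g) (c d : A) (i : Fin n) :
    qMap c d (g i) = ((4 : ℂ) • (half g c d i * half g c d i) +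
      (2 : ℂ) • (c * half g c d i - half g c d i * c)) * g i := by
  have h1 : g i * d = twist (g i) d * g i := (twist_mul_self (hg.sq i) d).symm
  have h2 : g i * d ^ 2 = twist (g i) d * twist (g i) d * g i := by
    rw [pow_two, ← mul_assoc, h1, mul_assoc, h1, ← mul_assoc]
  rw [qMap, h2, mul_assoc c, h1, half]
  generalize twist (g i) d = e
  simp only [mul_smul_comm, smul_mul_assoc, ← smul_sub, smul_smul]
  norm_num
  noncomm_ring

theorem mul_gen_cancel (hg : IsGammaSystem g) {x y : A} {i : Fin n} (h : x * g i = y * g i) :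
    x = y := by
  have := congrArg (· * g i) h
  simpa [mul_assoc, hg.sq] using this

theorem qMap_gen_eq_iff (hg : IsGammaSystem g) (c d : A) (i : Fin n) (l : ℂ) :
    qMap c d (g i) = l • g i ↔ (4 : ℂ) • (half g c d i * half g c d i) +
      (2 : ℂ) • (c * half g c d i - half g c d i * c) = l • 1 := by
  rw [hg.qMap_gen]
  constructor
  · intro h; exact hg.mul_gen_cancel (by rw [h, smul_mul_assoc, one_mul])
  · intro h; rw [h, smul_mul_assoc, one_mul]

/-- With `X = half g c d i` one has `s_{c,d}(g i) = 2 X (g i)` and `s_{d,c}(g i) = -2 (twist (g i)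
X) (g i)`; moving `g j` past `X` conjugates it. -/
theorem omega_gen (hg : IsGammaSystem g) (c d : A) {i j : Fin n} (hij : i ≠ j) :
    sMap d c (g i) * g j + g j * sMap c d (g i) =
      (-2 : ℂ) • ((twist (g i) (half g c d i) + twist (g j) (half g c d i)) * (g i * g j)) := by
  have h1 : sMap d c (g i) = (-2 : ℂ) • (twist (g i) (half g c d i) * g i) := by
    rw [half, map_smul, map_sub, twist_twist (hg.sq i), smul_mul_assoc, smul_smul, sub_mul,
      twist_mul_self (hg.sq i), sMap, ← neg_sub]
    norm_num
  have h2 : sMap c d (g i) = (2 : ℂ) • (half g c d i * g i) := by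
    rw [half, smul_mul_assoc, smul_smul, sub_mul, twist_mul_self (hg.sq i), sMap]
    norm_num
  rw [h1, h2, mul_smul_comm, ← mul_assoc (g j), ← twist_mul_self (hg.sq j), mul_assoc _ (g j),
    hg.anti j i hij.symm, smul_mul_assoc, mul_assoc]
  simp only [add_mul, mul_neg, smul_add, smul_neg, neg_smul]

theorem omega_gen_eq_zero_iff (hg : IsGammaSystem g) (c d : A) {i j : Fin n} (hij : i ≠ j) :
    sMap d c (g i) * g j + g j * sMap c d (g i) = 0 ↔
      twist (g j) (half g c d i) = -twist (g i) (half g c d i) := by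
  rw [hg.omega_gen c d hij, smul_eq_zero_iff_right (by norm_num), eq_neg_iff_add_eq_zero,
    add_comm]
  constructor
  · intro h
    refine hg.mul_gen_cancel (i := i) (hg.mul_gen_cancel (i := j) ?_)
    rw [mul_assoc, h]; simp
  · intro h; rw [h, zero_mul]

/-- Conjugation multiplies `Γ^*` by `-(-1)^n`, which is what the sign in the second component
compensates. Trivial pairs are thus invisible to `half`, and hence to `Ω`. -/
theorem half_trivial (hg : IsGammaSystem g) (t s : ℂ) (i : Fin n) :
    half g (t • 1 + s • bladeStar g) (t • 1 - ((-1) ^ n * s) • bladeStar g) i = 0 := by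
  rw [half, map_sub, hg.twist_smul_one, map_smul, hg.twist_bladeStar, smul_smul]
  have : (-1 : ℂ) ^ n * s * -(-1) ^ n = -s := by
    have : ((-1 : ℂ) ^ n) * (-1) ^ n = 1 := by rw [← pow_add, ← two_mul, pow_mul]; simp
    linear_combination -s * this
  rw [this]; simp

theorem half_add (c d c' d' : A) (i : Fin n) :
    half g (c + c') (d + d') i = half g c d i + half g c' d' i := by
  simp only [half, map_add]; module

theorem half_add_trivial (hg : IsGammaSystem g) (a b : A) (t s : ℂ) (i : Fin n) :
    half g (a + (t • 1 + s • bladeStar g)) (b + (t • 1 - ((-1) ^ n * s) • bladeStar g)) i =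
      half g a b i := by
  rw [half_add, hg.half_trivial, add_zero]

end IsGammaSystem

end CliffordPair

/-! ### Block sums and the shape of invariant pairs -/

namespace CliffordPair

variable {A : Type*} [Ring A] [Algebra ℂ A] {n m : ℕ}

/-- The first element of a generalized monomial pair. -/
def blockSum (g : Fin n → A) (I : Fin m → Finset (Fin n)) (x y : Fin m → ℂ) : A :=
  ∑ α, mono g (I α) (x α) (y α)

/-- The second element of a generalized monomial pair. -/
def blockSumBar (g : Fin n → A) (I : Fin m → Finset (Fin n)) (x y : Fin m → ℂ) : A :=
  ∑ α, ((-1 : ℂ) ^ (I α).card) • mono g (I α) (x α) (-y α)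

theorem neg_one_pow_mul_self (k : ℕ) : (-1 : ℂ) ^ k * (-1) ^ k = 1 := by
  rw [← pow_add, ← two_mul, pow_mul]; simp

namespace IsGammaSystem

variable {g : Fin n → A}

theorem twist_mono_eq_neg (hg : IsGammaSystem g) {i j : Fin n} {I : Finset (Fin n)} (hi : i ∈ I)
    (hj : j ∉ I) {x y : ℂ} (hy : Odd n → y = 0) :
    twist (g j) (mono g I x y) = -twist (g i) (mono g I x y) := by
  rw [hg.twist_mono_of_mem hi hy, hg.twist_mono_of_notMem hj hy, neg_smul, neg_neg]

/-- The signs in `blockSumBar` are such that conjugation by `g i` turns its summands into those of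
`blockSum`, except that the summand of the block of `i` changes sign and is therefore doubled in the
difference. -/
theorem half_blockSum (hg : IsGammaSystem g) {p : Fin n → Fin m} {I : Fin m → Finset (Fin n)}
    (hI : ∀ i α, i ∈ I α ↔ p i = α) {x y : Fin m → ℂ} (hy : Odd n → y = 0) (i : Fin n) :
    half g (blockSum g I x y) (blockSumBar g I x y) i = mono g (I (p i)) (x (p i)) (y (p i)) := by
  have hy' : ∀ α, Odd n → -y α = 0 := fun α ho => by simp [hy ho]
  have : blockSum g I x y - twist (g i) (blockSumBar g I x y) =
      ∑ α, if p i = α then (2 : ℂ) • mono g (I α) (x α) (y α) else 0 := by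
    rw [blockSum, blockSumBar, map_sum, ← Finset.sum_sub_distrib]
    refine Finset.sum_congr rfl fun α _ => ?_
    rw [map_smul]
    split_ifs with h
    · rw [hg.twist_mono_of_mem ((hI i α).2 h) (hy' α), smul_smul, mul_neg, neg_one_pow_mul_self,
        neg_neg]
      module
    · rw [hg.twist_mono_of_notMem (fun h' => h ((hI i α).1 h')) (hy' α), smul_smul,
        neg_one_pow_mul_self, neg_neg, one_smul, sub_self]
  rw [half, this]
  simp [smul_smul]

theorem omega_gen_eq_zero_of_half (hg : IsGammaSystem g) {c d : A} {i j : Fin n}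
    {I : Finset (Fin n)} (hi : i ∈ I) (hj : j ∉ I) {x y : ℂ} (hy : Odd n → y = 0)
    (h : half g c d i = mono g I x y) :
    sMap d c (g i) * g j + g j * sMap c d (g i) = 0 := by
  have hij : i ≠ j := fun e => hj (e ▸ hi)
  rw [hg.omega_gen_eq_zero_iff c d hij, h, hg.twist_mono_eq_neg hi hj hy]

section Forward

variable {p : Fin n → Fin m} {I : Fin m → Finset (Fin n)} {c d : A}

/-- If `k` lies in the block of `i` and `j`, conjugating `(c - g_i d g_i⁻¹) / 2` gives half of the
conjugate of `c` minus `d`, and `hc` applies. Otherwise both sides are minus the conjugate by `g k`.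
-/
theorem twist_half_congr (hg : IsGammaSystem g)
    (hc : ∀ i j, p i = p j → twist (g i) c = twist (g j) c)
    (hd : ∀ i j, p i = p j → twist (g i) d = twist (g j) d) {k i j : Fin n} (hij : p i = p j)
    (hΩ : ∀ i j, p i ≠ p j → twist (g j) (half g c d i) = -twist (g i) (half g c d i)) :
    twist (g i) (half g c d k) = twist (g j) (half g c d k) := by
  by_cases h : p i = p k
  · simp only [half, map_smul, map_sub]
    rw [hc i j hij, ← hd i k h, twist_twist (hg.sq i), hd i j hij, twist_twist (hg.sq j)]
  · rw [hΩ k i (fun e => h e.symm), hΩ k j (fun e => h (hij.trans e.symm))]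

theorem half_congr (hd : ∀ i j, p i = p j → twist (g i) d = twist (g j) d) {i j : Fin n}
    (hij : p i = p j) : half g c d i = half g c d j := by
  rw [half, half, hd i j hij]

/-- The shape of an invariant pair whose `Ω` vanishes off the blocks. -/
theorem exists_blockSum (hg : IsGammaSystem g) (hI : ∀ i α, i ∈ I α ↔ p i = α)
    (hp : Function.Surjective p) (hm : 0 < m)
    (hc : ∀ i j, p i = p j → twist (g i) c = twist (g j) c)
    (hd : ∀ i j, p i = p j → twist (g i) d = twist (g j) d)
    (hΩ : ∀ i j, p i ≠ p j → twist (g j) (half g c d i) = -twist (g i) (half g c d i)) :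
    ∃ (x y : Fin m → ℂ) (t s : ℂ), (Odd n → y = 0) ∧ (Odd n → s = 0) ∧
      c = blockSum g I x y + (t • 1 + s • bladeStar g) ∧
      d = blockSumBar g I x y + (t • 1 - ((-1) ^ n * s) • bladeStar g) := by
  -- One representative generator for each block.
  choose r hr using hp
  have hX : ∀ α, ∃ u v : ℂ, half g c d (r α) = mono g (I α) u v ∧ (Odd n → v = 0) := fun α => by
    refine hg.exists_eq_mono (I α) _ (fun i j hij => ?_) fun i j hi hj => ?_
    · rw [hI, hI] at hij
      by_cases h : p i = α
      · exact hg.twist_half_congr hc hd (h.trans (hij.1 h).symm) hΩ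
      · rw [hΩ (r α) i (by rw [hr]; exact Ne.symm h),
          hΩ (r α) j (by rw [hr]; exact fun e => h (hij.2 e.symm))]
    · rw [hI] at hi hj
      rw [hΩ (r α) j (by rw [hr]; exact Ne.symm hj),
        hg.twist_half_congr hc hd (i := i) (j := r α) (by rw [hr, hi]) hΩ]
  choose x y hxy hy using hX
  have hy0 : Odd n → y = 0 := fun ho => funext fun α => hy α ho
  have hhalf : ∀ i, half g c d i = half g (blockSum g I x y) (blockSumBar g I x y) i := fun i => by
    rw [hg.half_blockSum hI hy0, ← hxy, half_congr hd (j := r (p i)) (by rw [hr])]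
  -- Both pairs have the same halves, so the conjugate of the difference in `c` by any generator is
  -- the difference in `d`. Its conjugates therefore all agree.
  have hT : ∀ i, twist (g i) (c - blockSum g I x y) = d - blockSumBar g I x y := fun i => by
    have := congrArg (fun z => (2 : ℂ) • z) (hhalf i)
    simp only [half, smul_smul] at this
    norm_num at this
    rw [sub_eq_sub_iff_sub_eq_sub, ← map_sub] at this
    rw [this, twist_twist (hg.sq i)]
  obtain ⟨t, s, hts, hs⟩ := hg.exists_add_bladeStar (c - blockSum g I x y) fun i j => by
    rw [hT, hT]
  refine ⟨x, y, t, s, hy0, hs, by rw [← hts]; abel, ?_⟩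
  have h := hT (r ⟨0, hm⟩)
  rw [hts, map_add, hg.twist_smul_one, map_smul, hg.twist_bladeStar] at h
  rw [← sub_eq_iff_eq_add', ← h]
  module

end Forward

/-- Conjugation by `g i * g j` acts by a sign on each pseudo-monomial; this is the grading that
separates the blocks. -/
theorem twist_twist_mono (hg : IsGammaSystem g) {i j : Fin n} {I : Finset (Fin n)} {x y : ℂ}
    (hy : Odd n → y = 0) :
    twist (g i) (twist (g j) (mono g I x y)) =
      if (i ∈ I ↔ j ∈ I) then mono g I x y else -mono g I x y := by
  by_cases hi : i ∈ I <;> by_cases hj : j ∈ I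
  · rw [hg.twist_mono_of_mem hj hy, ← hg.twist_mono_of_mem hi hy, twist_twist (hg.sq i)]
    simp [hi, hj]
  · rw [hg.twist_mono_eq_neg hi hj hy, map_neg, twist_twist (hg.sq i)]
    simp [hi, hj]
  · rw [← neg_neg (twist (g j) (mono g I x y)), ← hg.twist_mono_eq_neg hj hi hy, map_neg,
      twist_twist (hg.sq i)]
    simp [hi, hj]
  · rw [hg.twist_mono_of_notMem hj hy, ← hg.twist_mono_of_notMem hi hy, twist_twist (hg.sq i)]
    simp [hi, hj]

theorem twist_trivial (hg : IsGammaSystem g) (i j : Fin n) (t s : ℂ) :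
    twist (g i) (twist (g j) (t • 1 + s • bladeStar g)) = t • 1 + s • bladeStar g := by
  have : twist (g j) (t • 1 + s • bladeStar g) = twist (g i) (t • 1 + s • bladeStar g) := by
    simp only [map_add, map_smul, hg.twist_bladeStar, twist_one (hg.sq _)]
  rw [this, twist_twist (hg.sq i)]

/-! ### Splitting the quadratic relation between blocks -/

section Quadratic

variable {p : Fin n → Fin m} {I : Fin m → Finset (Fin n)} {x y : Fin m → ℂ} {t s : ℂ}
  {l : Fin m → ℂ}

/-- Conjugation by a generator from block `α` and one from block `β` flips these two summands and
fixes the remainder `R`, trivial part included. The relation splits into a fixed part, with `X_α²`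
and `[X_β, X_α]`, and a flipped part `[R, X_α]`, which must vanish. -/
theorem quadratic_split (hg : IsGammaSystem g) (hI : ∀ i α, i ∈ I α ↔ p i = α)
    (hp : Function.Surjective p) (hy : Odd n → y = 0)
    (hq : ∀ α, (4 : ℂ) • (mono g (I α) (x α) (y α) * mono g (I α) (x α) (y α)) +
      (2 : ℂ) • ((blockSum g I x y + (t • 1 + s • bladeStar g)) * mono g (I α) (x α) (y α) -
        mono g (I α) (x α) (y α) * (blockSum g I x y + (t • 1 + s • bladeStar g))) =
      l α • 1) {α β : Fin m} (hαβ : β ≠ α) :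
    Commute (blockSum g I x y + (t • 1 + s • bladeStar g) - mono g (I β) (x β) (y β))
      (mono g (I α) (x α) (y α)) ∧
    (4 : ℂ) • (mono g (I α) (x α) (y α) * mono g (I α) (x α) (y α)) +
      (2 : ℂ) • (mono g (I β) (x β) (y β) * mono g (I α) (x α) (y α) -
        mono g (I α) (x α) (y α) * mono g (I β) (x β) (y β)) = l α • 1 := by
  obtain ⟨i, hi⟩ := hp α
  obtain ⟨j, hj⟩ := hp β
  have hyα : ∀ γ, Odd n → y γ = 0 := fun γ ho => by simp [hy ho]
  set X : Fin m → A := fun γ => mono g (I γ) (x γ) (y γ) with hX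
  set R := (∑ γ ∈ (Finset.univ.erase α).erase β, X γ) + (t • 1 + s • bladeStar g) with hR
  have hsum : blockSum g I x y + (t • 1 + s • bladeStar g) = R + X β + X α := by
    rw [blockSum, ← Finset.sum_erase_add _ _ (Finset.mem_univ α),
      ← Finset.sum_erase_add _ _ (Finset.mem_erase.2 ⟨hαβ, Finset.mem_univ β⟩), hR]
    abel
  have hΦ : ∀ γ, twist (g i) (twist (g j) (X γ)) = if γ = α ∨ γ = β then -X γ else X γ :=
    fun γ => by
    rw [hX, hg.twist_twist_mono (hyα γ)]
    simp only [hI, hi, hj]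
    rcases eq_or_ne γ α with h1 | h1
    · subst h1; simp [hαβ]
    · rcases eq_or_ne γ β with h2 | h2
      · subst h2; simp [h1.symm]
      · simp [h1, h2, h1.symm, h2.symm]
  have hΦR : twist (g i) (twist (g j) R) = R := by
    rw [hR, map_add, map_add, hg.twist_trivial, map_sum, map_sum]
    congr 1
    refine Finset.sum_congr rfl fun γ hγ => ?_
    simp only [Finset.mem_erase] at hγ
    rw [hΦ, if_neg (by tauto)]
  have hq1 := hq α
  rw [hsum] at hq1
  change (4 : ℂ) • (X α * X α) + (2 : ℂ) • ((R + X β + X α) * X α - X α * (R + X β + X α)) = _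
    at hq1
  have hq2 := congrArg (fun z => twist (g i) (twist (g j) z)) hq1
  simp only [map_add, map_sub, map_smul, twist_mul (hg.sq i), twist_mul (hg.sq j), hΦ, hΦR,
    twist_one (hg.sq _), true_or, or_true, if_true] at hq2
  have e1 : (4 : ℂ) • (X α * X α) + (2 : ℂ) • (X β * X α - X α * X β) +
      (2 : ℂ) • (R * X α - X α * R) = l α • 1 := by
    rw [← hq1]; simp only [add_mul, mul_add]; module
  have e2 : (4 : ℂ) • (X α * X α) + (2 : ℂ) • (X β * X α - X α * X β) -
      (2 : ℂ) • (R * X α - X α * R) = l α • 1 := by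
    rw [← hq2]; simp only [add_mul, mul_add, neg_mul, mul_neg]; module
  have e3 : R * X α - X α * R = 0 := by
    have : (4 : ℂ) • (R * X α - X α * R) = 0 := by
      rw [← sub_self (l α • (1 : A))]
      nth_rewrite 1 [← e1]
      rw [← e2]; module
    simpa using this
  refine ⟨?_, ?_⟩
  · rw [hsum]
    change (R + X β + X α - X β) * X α = X α * (R + X β + X α - X β)
    rw [show R + X β + X α - X β = R + X α by abel, add_mul, mul_add, sub_eq_zero.1 e3]
  · rw [e3, smul_zero, add_zero] at e1
    exact e1

/-- A third block `γ` allows a conjugation that flips `X_α` but fixes `X_β`. It preserves `X_α²` and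
negates the commutator, which is therefore zero. -/
theorem commute_mono (hg : IsGammaSystem g) (hI : ∀ i α, i ∈ I α ↔ p i = α)
    (hp : Function.Surjective p) (hm : 2 < m) (hy : Odd n → y = 0)
    (hq : ∀ α, (4 : ℂ) • (mono g (I α) (x α) (y α) * mono g (I α) (x α) (y α)) +
      (2 : ℂ) • ((blockSum g I x y + (t • 1 + s • bladeStar g)) * mono g (I α) (x α) (y α) -
        mono g (I α) (x α) (y α) * (blockSum g I x y + (t • 1 + s • bladeStar g))) =
      l α • 1) {α β : Fin m} (hαβ : β ≠ α) :
    Commute (mono g (I β) (x β) (y β)) (mono g (I α) (x α) (y α)) := by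
  obtain ⟨γ, hγα, hγβ⟩ : ∃ γ : Fin m, γ ≠ α ∧ γ ≠ β := by
    have : ({α, β} : Finset (Fin m)).card < (Finset.univ : Finset (Fin m)).card := by
      rw [Finset.card_univ, Fintype.card_fin]
      exact (Finset.card_le_two).trans_lt hm
    obtain ⟨γ, -, hγ⟩ := Finset.exists_mem_notMem_of_card_lt_card this
    simp only [Finset.mem_insert, Finset.mem_singleton, not_or] at hγ
    exact ⟨γ, hγ⟩
  have h1 := (hg.quadratic_split hI hp hy hq hαβ).2
  have h2 := (hg.quadratic_split hI hp hy hq hγα).2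
  obtain ⟨i, hi⟩ := hp α
  obtain ⟨j, hj⟩ := hp γ
  have hyα : ∀ γ, Odd n → y γ = 0 := fun γ ho => by simp [hy ho]
  have hΦα : twist (g i) (twist (g j) (mono g (I α) (x α) (y α))) =
      -mono g (I α) (x α) (y α) := by
    rw [hg.twist_twist_mono (hyα α)]; simp [hI, hi, hj, hγα]
  have hΦβ : twist (g i) (twist (g j) (mono g (I β) (x β) (y β))) =
      mono g (I β) (x β) (y β) := by
    rw [hg.twist_twist_mono (hyα β)]; simp [hI, hi, hj, hγβ, hαβ.symm]
  have h3 := congrArg (fun z => twist (g i) (twist (g j) z)) h1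
  simp only [map_add, map_sub, map_smul, twist_mul (hg.sq i), twist_mul (hg.sq j), hΦα, hΦβ,
    twist_one (hg.sq _)] at h3
  have : (4 : ℂ) • (mono g (I β) (x β) (y β) * mono g (I α) (x α) (y α) -
      mono g (I α) (x α) (y α) * mono g (I β) (x β) (y β)) = 0 := by
    rw [← sub_self (l α • (1 : A))]
    nth_rewrite 1 [← h1]
    rw [← h3]; simp only [neg_mul, mul_neg]; module
  rw [smul_eq_zero_iff_right (by norm_num), sub_eq_zero] at this
  exact this

theorem mono_sq_of_quadratic (hg : IsGammaSystem g) (hI : ∀ i α, i ∈ I α ↔ p i = α)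
    (hp : Function.Surjective p) (hm : 2 < m) (hy : Odd n → y = 0)
    (hq : ∀ α, (4 : ℂ) • (mono g (I α) (x α) (y α) * mono g (I α) (x α) (y α)) +
      (2 : ℂ) • ((blockSum g I x y + (t • 1 + s • bladeStar g)) * mono g (I α) (x α) (y α) -
        mono g (I α) (x α) (y α) * (blockSum g I x y + (t • 1 + s • bladeStar g))) =
      l α • 1) (α : Fin m) :
    (4 : ℂ) • (mono g (I α) (x α) (y α) * mono g (I α) (x α) (y α)) = l α • 1 := by
  have : Nontrivial (Fin m) := Fin.nontrivial_iff_two_le.2 (by omega)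
  obtain ⟨β, hβ⟩ := exists_ne α
  have h1 := (hg.quadratic_split hI hp hy hq hβ).2
  rw [(hg.commute_mono hI hp hm hy hq hβ).eq, sub_self, smul_zero, add_zero] at h1
  exact h1

/-- This allows the trivial pair to be removed without changing `q`. For `m = 2` it is the vanishing
flipped part alone; for larger `m` the other blocks are subtracted with `commute_mono`. -/
theorem commute_trivial (hg : IsGammaSystem g) (hI : ∀ i α, i ∈ I α ↔ p i = α)
    (hp : Function.Surjective p) (hm : 2 ≤ m) (hy : Odd n → y = 0)
    (hq : ∀ α, (4 : ℂ) • (mono g (I α) (x α) (y α) * mono g (I α) (x α) (y α)) +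
      (2 : ℂ) • ((blockSum g I x y + (t • 1 + s • bladeStar g)) * mono g (I α) (x α) (y α) -
        mono g (I α) (x α) (y α) * (blockSum g I x y + (t • 1 + s • bladeStar g))) =
      l α • 1) (α : Fin m) :
    Commute (t • 1 + s • bladeStar g) (mono g (I α) (x α) (y α)) := by
  have : Nontrivial (Fin m) := Fin.nontrivial_iff_two_le.2 hm
  obtain ⟨β, hβ⟩ := exists_ne α
  have h1 := (hg.quadratic_split hI hp hy hq hβ).1
  have e : t • 1 + s • bladeStar g =
      (blockSum g I x y + (t • 1 + s • bladeStar g) - mono g (I β) (x β) (y β)) -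
        mono g (I α) (x α) (y α) -
        ∑ γ ∈ (Finset.univ.erase α).erase β, mono g (I γ) (x γ) (y γ) := by
    rw [blockSum, ← Finset.sum_erase_add _ _ (Finset.mem_univ α),
      ← Finset.sum_erase_add _ _ (Finset.mem_erase.2 ⟨hβ, Finset.mem_univ β⟩)]
    abel
  rw [e]
  refine (h1.sub_left (Commute.refl _)).sub_left (Commute.sum_left _ _ _ fun γ hγ => ?_)
  simp only [Finset.mem_erase] at hγ
  -- A summand `γ` occurs here only if there is a third block.
  have hm' : 2 < m := by
    have : ({α, β, γ} : Finset (Fin m)).card = 3 := by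
      rw [Finset.card_eq_three]; exact ⟨α, β, γ, hβ.symm, Ne.symm hγ.2.1, Ne.symm hγ.1, rfl⟩
    have h2 := Finset.card_le_univ ({α, β, γ} : Finset (Fin m))
    rw [this, Fintype.card_fin] at h2
    omega
  exact hg.commute_mono hI hp hm' hy hq hγ.2.1

end Quadratic

/-- The trivial pair enters `q` only through its commutator with `X_i`. -/
theorem qMap_gen_eq_of_commute (hg : IsGammaSystem g) {a b : A} {t s : ℂ} {i : Fin n}
    (h : Commute (t • 1 + s • bladeStar g) (half g a b i)) :
    qMap (a + (t • 1 + s • bladeStar g)) (b + (t • 1 - ((-1) ^ n * s) • bladeStar g)) (g i) =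
      qMap a b (g i) := by
  rw [hg.qMap_gen, hg.qMap_gen, hg.half_add_trivial, add_mul a, mul_add _ a, h.eq]
  congr 3
  abel

theorem commute_mono_mono (hg : IsGammaSystem g) {I J : Finset (Fin n)} (hIJ : Disjoint I J)
    {x y x' y' : ℂ} (hy : Odd n → y = 0) (hy' : Odd n → y' = 0)
    (h1 : x * x' + (-1) ^ I.card * (y * y') =
      (-1) ^ (I.card * J.card) * (x * x' + (-1) ^ J.card * (y * y')))
    (h2 : (-1) ^ I.card * (x * y') + y * x' =
      (-1) ^ (I.card * J.card) * ((-1) ^ J.card * (y * x') + x * y')) :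
    Commute (mono g I x y) (mono g J x' y') := by
  rw [Commute, SemiconjBy, hg.mono_mul_mono I J hy', hg.mono_mul_mono J I hy,
    hg.blade_mul_blade hIJ, mul_smul_comm, ← smul_mul_assoc]
  congr 1
  simp only [bladeLin, smul_add, smul_smul]
  rw [h1, h2]
  congr 2 <;> ring

/-- After `Γ_I Γ_J` is cancelled, the two equations are the coefficients of `1` and `Γ^*`. -/
theorem commute_mono_mono_iff [Nontrivial A] (hg : IsGammaSystem g) (i : Fin n)
    {I J : Finset (Fin n)} (hIJ : Disjoint I J) {x y x' y' : ℂ} (hy : Odd n → y = 0)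
    (hy' : Odd n → y' = 0) (h : Commute (mono g I x y) (mono g J x' y')) :
    x * x' + (-1) ^ I.card * (y * y') =
      (-1) ^ (I.card * J.card) * (x * x' + (-1) ^ J.card * (y * y')) ∧
    (-1) ^ I.card * (x * y') + y * x' =
      (-1) ^ (I.card * J.card) * ((-1) ^ J.card * (y * x') + x * y') := by
  rw [Commute, SemiconjBy, hg.mono_mul_mono I J hy', hg.mono_mul_mono J I hy,
    hg.blade_mul_blade hIJ, mul_smul_comm, ← smul_mul_assoc, ← sub_eq_zero, ← sub_mul,
    ← mul_assoc] at h
  have h0 := hg.mul_blade_eq_zero (hg.mul_blade_eq_zero h)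
  rw [bladeLin, bladeLin, smul_add, smul_smul, smul_smul, add_sub_add_comm, ← sub_smul,
    ← sub_smul] at h0
  obtain ⟨e1, e2⟩ := hg.bladeLin_eq_zero i (fun ho => by rw [hy ho, hy' ho]; ring) h0
  exact ⟨by linear_combination e1, by linear_combination e2⟩

theorem mono_sq_iff [Nontrivial A] (hg : IsGammaSystem g) (i : Fin n) {I : Finset (Fin n)}
    {x y l : ℂ} (hy : Odd n → y = 0) (h : (4 : ℂ) • (mono g I x y * mono g I x y) = l • 1) :
    4 * (-1) ^ (I.card * (I.card + 1) / 2) * (x * x + (-1) ^ I.card * (y * y)) = l ∧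
      ((-1) ^ I.card + 1) * (x * y) = 0 := by
  rw [hg.mono_mul_mono_self I hy, smul_smul, bladeLin, smul_add, smul_smul, smul_smul,
    ← sub_eq_zero, add_sub_right_comm, ← sub_smul] at h
  obtain ⟨e1, e2⟩ := hg.bladeLin_eq_zero i (fun ho => by rw [hy ho]; ring) h
  refine ⟨by linear_combination e1, ?_⟩
  have h3 : (4 * (-1 : ℂ) ^ (I.card * (I.card + 1) / 2)) ≠ 0 := by simp
  have := (mul_eq_zero.1 e2).resolve_left h3
  linear_combination this

end IsGammaSystem

end CliffordPair

/-! ### Coefficient conditions, polar form and complementary blades -/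

namespace CliffordPair

variable {A : Type*} [Ring A] [Algebra ℂ A] {n m : ℕ}

theorem mono_add (g : Fin n → A) (I : Finset (Fin n)) (x y x' y' : ℂ) :
    mono g I x y + mono g I x' y' = mono g I (x + x') (y + y') := by
  simp only [mono, bladeLin, ← add_mul]; congr 1; module

theorem smul_mono (g : Fin n → A) (I : Finset (Fin n)) (z x y : ℂ) :
    z • mono g I x y = mono g I (z * x) (z * y) := by
  simp only [mono, bladeLin, ← smul_mul_assoc]; congr 1; module

theorem mono_zero_right (g : Fin n → A) (I : Finset (Fin n)) (x : ℂ) :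
    mono g I x 0 = x • blade g I := by
  simp [mono, bladeLin]

theorem blockSum_eq (g : Fin n → A) (I : Fin m → Finset (Fin n)) (x y : Fin m → ℂ) :
    blockSum g I x y =
      ∑ α, x α • blade g (I α) + bladeStar g * ∑ α, y α • blade g (I α) := by
  rw [blockSum, Finset.mul_sum, ← Finset.sum_add_distrib]
  exact Finset.sum_congr rfl fun α _ => by simp [mono, bladeLin, add_mul]

theorem blockSumBar_eq (g : Fin n → A) (I : Fin m → Finset (Fin n)) (x y : Fin m → ℂ) :
    blockSumBar g I x y =
      ∑ α, ((-1) ^ (I α).card * x α) • blade g (I α) -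
        bladeStar g * ∑ α, ((-1) ^ (I α).card * y α) • blade g (I α) := by
  rw [blockSumBar, Finset.mul_sum, ← Finset.sum_sub_distrib]
  refine Finset.sum_congr rfl fun α _ => ?_
  rw [smul_mono, mono, bladeLin, add_mul, smul_mul_assoc, one_mul, smul_mul_assoc, mul_smul_comm]
  module

/-- The coefficient conditions for generalized monomial pairs. -/
theorem odd_blocks_classification {x y l : Fin m → ℂ} {k : Fin m → ℕ}
    (hl : Function.Injective l)
    (hsq : ∀ α, 4 * (-1 : ℂ) ^ (k α * (k α + 1) / 2) * (x α * x α + (-1) ^ k α * (y α * y α)) =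
      l α ∧ ((-1) ^ k α + 1) * (x α * y α) = 0)
    (hc : ∀ α β, α ≠ β →
      x α * x β + (-1) ^ k α * (y α * y β) =
        (-1) ^ (k α * k β) * (x α * x β + (-1) ^ k β * (y α * y β)) ∧
      (-1) ^ k α * (x α * y β) + y α * x β =
        (-1) ^ (k α * k β) * ((-1) ^ k β * (y α * x β) + x α * y β))
    (hn : Odd n ↔ Odd (∑ α, k α)) (hy : Odd n → y = 0) :
    (y = 0 ∧ ∀ α β, Odd (k α) → Odd (k β) → α = β) ∨
      ((∀ α, Even (k α) ∧ x α * y α = 0) ∨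
        ∃ α₀ α₁, α₀ ≠ α₁ ∧ Odd (k α₀) ∧ Odd (k α₁) ∧ x α₀ * x α₁ = y α₀ * y α₁ ∧
          ∀ α, α ≠ α₀ → α ≠ α₁ → Even (k α) ∧ y α = 0) := by
  have hE : ∀ α, Even (k α) → x α * y α = 0 := fun α h => by
    have := (hsq α).2
    rw [h.neg_one_pow] at this
    linear_combination this / 2
  have hl0 : ∀ α, Odd (k α) → x α * x α = y α * y α → l α = 0 := fun α h h' => by
    rw [← (hsq α).1, h.neg_one_pow, h']; ring
  have heo : ∀ α β, Even (k α) → Odd (k β) → y α * y β = 0 ∧ y α * x β = 0 := fun α β h h' => by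
    have hne : α ≠ β := fun e => (Nat.not_even_iff_odd.2 h') (e ▸ h)
    obtain ⟨h1, h2⟩ := hc α β hne
    rw [h.neg_one_pow, h'.neg_one_pow, (h.mul_right _).neg_one_pow] at h1 h2
    exact ⟨by linear_combination h1 / 2, by linear_combination h2 / 2⟩
  -- Coefficient vectors of distinct odd blocks are orthogonal for the form `x x' - y y'` on `ℂ²`,
  -- and an isotropic one has eigenvalue zero by `hl0`.
  have hoo : ∀ α β, α ≠ β → Odd (k α) → Odd (k β) → x α * x β = y α * y β :=
    fun α β hne h h' => by
    have h1 := (hc α β hne).1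
    rw [h.neg_one_pow, h'.neg_one_pow, (h.mul h').neg_one_pow] at h1
    linear_combination h1 / 2
  set O := Finset.univ.filter fun α => Odd (k α) with hO
  have hmem : ∀ α, α ∈ O ↔ Odd (k α) := fun α => by simp [hO]
  have hnO : Odd n ↔ Odd O.card := hn.trans (Finset.odd_sum_iff_odd_card_odd k)
  rcases n.even_or_odd with hev | hodd
  · right
    -- Distinct eigenvalues leave room for only one isotropic odd block.
    have hiso : (O.filter fun α => x α * x α = y α * y α).card ≤ 1 := by
      rw [Finset.card_le_one]
      intro α hα β hβ
      simp only [Finset.mem_filter, hmem] at hα hβ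
      exact hl ((hl0 α hα.1 hα.2).trans (hl0 β hβ.1 hβ.2).symm)
    -- At most two pairwise orthogonal anisotropic vectors fit into a plane.
    have hani : (O.filter fun α => ¬x α * x α = y α * y α).card ≤ 2 := by
      by_contra! h
      obtain ⟨a, ha, b, hb, c, hc', hab, hac, hbc⟩ := Finset.two_lt_card.1 h
      simp only [Finset.mem_filter, hmem] at ha hb hc'
      have h1 := hoo a b hab ha.1 hb.1
      have h2 := hoo a c hac ha.1 hc'.1
      have h3 := hoo b c hbc hb.1 hc'.1
      by_cases hxa : x a = 0
      · have hya : y a ≠ 0 := fun h0 => ha.2 (by rw [hxa, h0])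
        rw [hxa, zero_mul, eq_comm] at h1 h2
        have hyb := (mul_eq_zero.1 h1).resolve_left hya
        have hyc := (mul_eq_zero.1 h2).resolve_left hya
        rw [hyb, zero_mul] at h3
        rcases mul_eq_zero.1 h3 with h0 | h0
        · exact hb.2 (by rw [h0, hyb])
        · exact hc'.2 (by rw [h0, hyc])
      -- Both `b` and `c` are orthogonal to `a`, hence parallel. Since they are also orthogonal and
      -- `b` is anisotropic, `c` would be zero.
      · have hdet : x b * y c = x c * y b := by
          apply mul_left_cancel₀ hxa
          linear_combination y c * h1 - y b * h2
        have hyc : y c * (x b * x b - y b * y b) = 0 := by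
          linear_combination x b * hdet + y b * h3
        have hxc : x c * (x b * x b - y b * y b) = 0 := by
          linear_combination x b * h3 + y b * hdet
        have hb0 := sub_ne_zero.2 hb.2
        have := (mul_eq_zero.1 hyc).resolve_right hb0
        have h0 := (mul_eq_zero.1 hxc).resolve_right hb0
        exact hc'.2 (by rw [this, h0])
    have hcard := Finset.card_filter_add_card_filter_not (s := O)
      (fun α => x α * x α = y α * y α)
    have hOev : Even O.card := by
      rw [← Nat.not_odd_iff_even, ← hnO]; exact Nat.not_odd_iff_even.2 hev
    -- At most `1 + 2` odd blocks, and an even number of them.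
    have h02 : O.card = 0 ∨ O.card = 2 := by
      obtain ⟨r, hr⟩ := hOev; omega
    rcases h02 with h | h
    · left
      rw [Finset.card_eq_zero] at h
      intro α
      have hα : Even (k α) := by
        rw [← Nat.not_odd_iff_even, ← hmem, h]; simp
      exact ⟨hα, hE α hα⟩
    · right
      obtain ⟨α₀, α₁, hne, hO2⟩ := Finset.card_eq_two.1 h
      have h0 : Odd (k α₀) := by rw [← hmem, hO2]; simp
      have h1 : Odd (k α₁) := by rw [← hmem, hO2]; simp
      refine ⟨α₀, α₁, hne, h0, h1, hoo _ _ hne h0 h1, fun α hα0 hα1 => ?_⟩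
      have hα : Even (k α) := by
        rw [← Nat.not_odd_iff_even, ← hmem, hO2]; simp [hα0, hα1]
      refine ⟨hα, ?_⟩
      -- If an even block had `y ≠ 0`, commuting with it would kill the coefficients of both odd
      -- blocks and make their eigenvalues equal.
      by_contra hyα
      have e0 := heo α α₀ hα h0
      have e1 := heo α α₁ hα h1
      simp only [mul_eq_zero, hyα, false_or] at e0 e1
      exact hne (hl ((hl0 _ h0 (by rw [e0.1, e0.2])).trans (hl0 _ h1 (by rw [e1.1, e1.2])).symm))
  · left
    have hy0 := hy hodd
    refine ⟨hy0, ?_⟩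
    -- With `y = 0`, orthogonality is `x α * x β = 0`. Three odd blocks would include two with `x =
    -- 0`, hence with equal eigenvalues.
    have hO1 : O.card ≤ 2 := by
      by_contra! h
      obtain ⟨a, ha, b, hb, c, hc', hab, hac, hbc⟩ := Finset.two_lt_card.1 h
      rw [hmem] at ha hb hc'
      have h1 := hoo a b hab ha hb
      have h2 := hoo a c hac ha hc'
      have h3 := hoo b c hbc hb hc'
      simp only [hy0, Pi.zero_apply, mul_zero, mul_eq_zero] at h1 h2 h3
      have hz : ∀ α, Odd (k α) → x α = 0 → l α = 0 := fun α h h' => hl0 α h (by simp [h', hy0])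
      have hinj : ∀ α β, Odd (k α) → Odd (k β) → α ≠ β → x α = 0 → x β ≠ 0 :=
        fun α β hα hβ hne h h' => hne (hl ((hz α hα h).trans (hz β hβ h').symm))
      have := hinj a b ha hb hab
      have := hinj a c ha hc' hac
      have := hinj b c hb hc' hbc
      tauto
    obtain ⟨r, hr⟩ := hnO.1 hodd
    have h1 : O.card ≤ 1 := by omega
    intro α β hα hβ
    exact Finset.card_le_one.1 h1 α ((hmem α).2 hα) β ((hmem β).2 hβ)

/-- For `b ≠ 0` take `cot φ = ‖a / b‖` and `ψ` the argument of `a / b`; the common factor is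
absorbed in `r`. -/
theorem exists_polar_pair (a b : ℂ) : ∃ (r : ℂ) (φ ψ : ℝ),
    a = r * ((Real.cos φ : ℂ) * Complex.exp (Complex.I * ψ)) ∧ b = r * (Real.sin φ : ℂ) := by
  by_cases hb : b = 0
  · exact ⟨a, 0, 0, by simp, by simp [hb]⟩
  set z := a / b with hz
  set φ := Real.pi / 2 - Real.arctan ‖z‖ with hφ
  have hs : Real.sin φ = Real.cos (Real.arctan ‖z‖) := Real.sin_pi_div_two_sub _
  have hc : Real.cos φ = Real.sin (Real.arctan ‖z‖) := Real.cos_pi_div_two_sub _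
  have hs0 : Real.sin φ ≠ 0 := by rw [hs]; exact (Real.cos_arctan_pos _).ne'
  have hcs : Real.cos φ = ‖z‖ * Real.sin φ := by
    rw [hc, hs]
    nth_rewrite 2 [← Real.tan_arctan ‖z‖]
    rw [Real.tan_mul_cos (Real.cos_arctan_pos _).ne']
  have hs0' : (Real.sin φ : ℂ) ≠ 0 := by exact_mod_cast hs0
  have hza : a = z * b := by rw [hz, div_mul_cancel₀ _ hb]
  refine ⟨b / (Real.sin φ : ℂ), φ, Complex.arg z, ?_, by rw [div_mul_cancel₀ _ hs0']⟩
  have hp : (‖z‖ : ℂ) * Complex.exp (Complex.I * Complex.arg z) = z := by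
    rw [mul_comm Complex.I]; exact Complex.norm_mul_exp_arg_mul_I z
  rw [hcs, hza]
  nth_rewrite 1 [← hp]
  rw [Complex.ofReal_mul]
  field_simp

/-- The hypothesis says that `(a, b)` and `(c, -d)` are linearly dependent, so they share the angles
of a nonzero one. -/
theorem exists_polar_pair_conj {a b c d : ℂ} (h : a * d + b * c = 0) :
    ∃ (r r' : ℂ) (φ ψ : ℝ),
      (a = r * ((Real.cos φ : ℂ) * Complex.exp (Complex.I * ψ)) ∧ b = r * (Real.sin φ : ℂ)) ∧
      (c = r' * ((Real.cos φ : ℂ) * Complex.exp (Complex.I * ψ)) ∧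
        d = r' * -(Real.sin φ : ℂ)) := by
  by_cases ha : a = 0
  · by_cases hb : b = 0
    · obtain ⟨r, φ, ψ, h1, h2⟩ := exists_polar_pair c (-d)
      exact ⟨0, r, φ, ψ, by simp [ha, hb], h1, by linear_combination -h2⟩
    · obtain ⟨r, φ, ψ, h1, h2⟩ := exists_polar_pair a b
      have hc : c = 0 := by simpa [ha, hb] using h
      refine ⟨r, -d / b * r, φ, ψ, ⟨h1, h2⟩, ?_, ?_⟩
      · rw [mul_assoc, ← h1, hc, ha, mul_zero]
      · rw [mul_neg, mul_assoc, ← h2]; field_simp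
  · obtain ⟨r, φ, ψ, h1, h2⟩ := exists_polar_pair a b
    refine ⟨r, c / a * r, φ, ψ, ⟨h1, h2⟩, ?_, ?_⟩
    · rw [mul_assoc, ← h1, div_mul_cancel₀ _ ha]
    · rw [mul_neg, mul_assoc, ← h2]; field_simp; linear_combination h

namespace IsGammaSystem

variable {g : Fin n → A}

/-- The product `Γ^* Γ_I Γ_{Iᶜ}` is fixed by every conjugation, hence scalar. -/
theorem exists_bladeStar_mul_blade (hg : IsGammaSystem g) (hn : Even n) (I : Finset (Fin n)) :
    ∃ z : ℂ, bladeStar g * blade g I = z • blade g Iᶜ := by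
  have hcard : (-1 : ℂ) ^ I.card * (-1) ^ Iᶜ.card = 1 := by
    rw [← pow_add, Finset.card_add_card_compl, Fintype.card_fin, hn.neg_one_pow]
  obtain ⟨z, hz⟩ := hg.exists_smul_one (bladeStar g * blade g I * blade g Iᶜ) fun i => by
    rw [twist_mul (hg.sq i), twist_mul (hg.sq i), hg.twist_bladeStar_of_even hn]
    by_cases hi : i ∈ I
    · rw [hg.twist_blade_of_mem hi, hg.twist_blade_of_notMem (by simpa using hi)]
      simp only [neg_mul, mul_smul_comm, smul_mul_assoc, neg_smul, mul_neg, smul_neg, neg_neg,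
        smul_smul, mul_comm ((-1 : ℂ) ^ Iᶜ.card), hcard, one_smul]
    · rw [hg.twist_blade_of_notMem hi, hg.twist_blade_of_mem (I := Iᶜ) (by simpa using hi)]
      simp only [neg_mul, mul_smul_comm, smul_mul_assoc, neg_smul, mul_neg, smul_neg, neg_neg,
        smul_smul, mul_comm ((-1 : ℂ) ^ Iᶜ.card), hcard, one_smul]
  refine ⟨(-1) ^ (Iᶜ.card * (Iᶜ.card + 1) / 2) * z, ?_⟩
  have h := congrArg (· * blade g Iᶜ) hz
  simp only [mul_assoc, hg.blade_sq, smul_mul_assoc, one_mul, mul_smul_comm, mul_one] at h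
  rw [mul_smul, ← h, smul_smul, neg_one_pow_mul_self, one_smul]

/-- The sign pattern that characterizes pseudo-monomials is symmetric under exchanging `I` and its
complement. -/
theorem exists_mono_compl (hg : IsGammaSystem g) (I : Finset (Fin n)) {x y : ℂ}
    (hy : Odd n → y = 0) :
    ∃ u v : ℂ, mono g Iᶜ x y = mono g I u v ∧ (Odd n → v = 0) := by
  refine hg.exists_eq_mono I _ (fun i j hij => ?_) fun i j hi hj => ?_
  · by_cases hi : i ∈ I
    · rw [hg.twist_mono_of_notMem (by simpa using hi) hy,
        hg.twist_mono_of_notMem (by simpa using hij.1 hi) hy]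
    · rw [hg.twist_mono_of_mem (by simpa using hi) hy,
        hg.twist_mono_of_mem (by simpa [← hij] using hi) hy]
  · rw [hg.twist_mono_eq_neg (i := j) (j := i) (by simpa using hj) (by simpa using hi) hy, neg_neg]

theorem half_mono (hg : IsGammaSystem g) (I : Finset (Fin n)) {x y x' y' : ℂ}
    (hy' : Odd n → y' = 0) (i : Fin n) {η : ℂ}
    (hη : η = if i ∈ I then -(-1 : ℂ) ^ I.card else (-1) ^ I.card) :
    half g (mono g I x y) (mono g I x' y') i =
      mono g I (2⁻¹ * (x - η * x')) (2⁻¹ * (y + η * y')) := by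
  have h : twist (g i) (mono g I x' y') = η • mono g I x' (-y') := by
    rw [hη]
    split_ifs with hi
    · exact hg.twist_mono_of_mem hi hy'
    · exact hg.twist_mono_of_notMem hi hy'
  rw [half, h, ← smul_mono, sub_eq_add_neg, ← neg_smul, smul_mono g I (-η), mono_add]
  congr 2 <;> ring

theorem qMap_mono (hg : IsGammaSystem g) (I : Finset (Fin n)) {x y x' y' : ℂ}
    (hy : Odd n → y = 0) (hy' : Odd n → y' = 0) (i : Fin n) {η : ℂ}
    (hη : η = if i ∈ I then -(-1 : ℂ) ^ I.card else (-1) ^ I.card) :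
    qMap (mono g I x y) (mono g I x' y') (g i) =
      ((-1 : ℂ) ^ (I.card * (I.card + 1) / 2) •
        bladeLin g ((x - η * x') ^ 2 + (-1) ^ I.card * (y + η * y') ^ 2)
          (((-1) ^ I.card + 1) * ((x - η * x') * (y + η * y')) +
            ((-1) ^ I.card - 1) * (η * (x * y' + y * x')))) * g i := by
  have hy2 : Odd n → 2⁻¹ * (y + η * y') = 0 := fun ho => by rw [hy ho, hy' ho]; ring
  rw [hg.qMap_gen, hg.half_mono I hy' i hη, hg.mono_mul_mono_self I hy2,
    hg.mono_mul_mono_self I hy2, hg.mono_mul_mono_self I hy]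
  congr 1
  simp only [bladeLin]
  module

/-- The left side is, up to a sign, the `Γ^*`-coefficient of `q(g i) (g i)⁻¹`, the only obstruction
to `g i` being an eigenvector of `q`. -/
theorem qMap_mono_eq_iff [Nontrivial A] (hg : IsGammaSystem g) (I : Finset (Fin n))
    {x y x' y' l : ℂ} (hy : Odd n → y = 0) (hy' : Odd n → y' = 0) (i : Fin n) {η : ℂ}
    (hη : η = if i ∈ I then -(-1 : ℂ) ^ I.card else (-1) ^ I.card)
    (h : qMap (mono g I x y) (mono g I x' y') (g i) = l • g i) :
    ((-1) ^ I.card + 1) * ((x - η * x') * (y + η * y')) +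
      ((-1) ^ I.card - 1) * (η * (x * y' + y * x')) = 0 := by
  rw [hg.qMap_mono I hy hy' i hη] at h
  have h1 := hg.mul_gen_cancel (i := i) (y := l • (1 : A)) (by rw [h, smul_mul_assoc, one_mul])
  rw [bladeLin, smul_add, smul_smul, smul_smul, ← sub_eq_zero, add_sub_right_comm,
    ← sub_smul] at h1
  obtain ⟨-, e2⟩ := hg.bladeLin_eq_zero i (fun ho => by rw [hy ho, hy' ho]; ring) h1
  exact (mul_eq_zero.1 e2).resolve_left (by simp)

end IsGammaSystem

end CliffordPair

/-! ### Clifford maps: invariance and `so_B(V) ⊗ A` in an eigenbasis -/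

namespace CliffordPair

variable {V A : Type*} [NormedAddCommGroup V] [InnerProductSpace ℝ V] [Ring A] [Algebra ℂ A]
  {n : ℕ}

/-- A Clifford map whose values have only the scalars as their centralizer. -/
structure IsCliffordMap (G : V → A) : Prop where
  add : ∀ v w, G (v + w) = G v + G w
  smul : ∀ (r : ℝ) v, G (r • v) = (r : ℂ) • G v
  anticomm : ∀ v w, G v * G w + G w * G v = ((-2 * inner ℝ v w : ℝ) : ℂ) • 1
  central : ∀ x, (∀ v, G v * x = x * G v) → ∃ z : ℂ, x = z • 1

/-- The skew-symmetric endomorphism `v ↦ ⟪x, v⟫ y - ⟪y, v⟫ x`. -/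
def wedgeEnd (x y : V) : V →ₗ[ℝ] V :=
  (innerₗ V x).smulRight y - (innerₗ V y).smulRight x

theorem wedgeEnd_apply (x y v : V) : wedgeEnd x y v = inner ℝ x v • y - inner ℝ y v • x := rfl

theorem wedgeEnd_mem_soB {B : V →ₗ[ℝ] V} (hB : B.IsSymmetric) {x y : V} {r : ℝ}
    (hx : B x = r • x) (hy : B y = r • y) : wedgeEnd x y ∈ soB B := by
  refine ⟨fun v w => ?_, LinearMap.ext fun v => ?_⟩
  · simp only [wedgeEnd_apply, inner_sub_left, inner_sub_right, real_inner_smul_left,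
      real_inner_smul_right, real_inner_comm v x, real_inner_comm v y]
    ring
  · have h1 : inner ℝ x (B v) = r * inner ℝ x v := by
      rw [← hB, hx, real_inner_smul_left]
    have h2 : inner ℝ y (B v) = r * inner ℝ y v := by
      rw [← hB, hy, real_inner_smul_left]
    simp only [LinearMap.comp_apply, wedgeEnd_apply, h1, h2, map_sub, map_smul, hx, hy]
    module

namespace IsCliffordMap

variable {G : V → A}

theorem zero (hG : IsCliffordMap G) : G 0 = 0 := by
  simpa using hG.smul 0 0

theorem sum (hG : IsCliffordMap G) {ι : Type*} (s : Finset ι) (f : ι → V) :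
    G (∑ i ∈ s, f i) = ∑ i ∈ s, G (f i) := by
  classical
  induction s using Finset.induction_on with
  | empty => simp [hG.zero]
  | insert a s ha ih => rw [Finset.sum_insert ha, Finset.sum_insert ha, hG.add, ih]

theorem expand (hG : IsCliffordMap G) {ι : Type*} [Fintype ι] (e : OrthonormalBasis ι ℝ V)
    (v : V) : G v = ∑ i, ((inner ℝ (e i) v : ℝ) : ℂ) • G (e i) := by
  conv_lhs => rw [← e.sum_repr' v, hG.sum]
  simp only [hG.smul]

theorem isGammaSystem (hG : IsCliffordMap G) (e : OrthonormalBasis (Fin n) ℝ V) :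
    IsGammaSystem fun i => G (e i) where
  sq i := by
    have h := hG.anticomm (e i) (e i)
    rw [e.inner_eq_one, ← two_smul ℂ] at h
    have := congrArg (fun z => (2⁻¹ : ℂ) • z) h
    simpa [smul_smul] using this
  anti i j hij := by
    have h := hG.anticomm (e i) (e j)
    rw [e.inner_eq_zero hij] at h
    rw [eq_neg_iff_add_eq_zero, h]; simp
  central x hx := hG.central x fun v => by
    rw [hG.expand e v, Finset.sum_mul, Finset.mul_sum]
    exact Finset.sum_congr rfl fun i _ => by rw [smul_mul_assoc, hx, mul_smul_comm]

theorem isPairFor_of_basis (hG : IsCliffordMap G) (e : OrthonormalBasis (Fin n) ℝ V)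
    {B : V →ₗ[ℝ] V} (hB : B.IsSymmetric) {a b : A}
    (h : ∀ i, qMap a b (G (e i)) = G (B (e i))) : IsPairFor G B a b := by
  refine ⟨hB, fun v => ?_⟩
  have hlin : ∀ (z : Fin n → ℂ), qMap a b (∑ i, z i • G (e i)) =
      ∑ i, z i • qMap a b (G (e i)) := fun z => by
    simp only [qMap, Finset.mul_sum, Finset.sum_mul, mul_smul_comm, smul_mul_assoc, smul_add,
      smul_sub, Finset.sum_add_distrib, Finset.sum_sub_distrib]
  have hBv : B v = ∑ i, inner ℝ (e i) v • B (e i) := by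
    conv_lhs => rw [← e.sum_repr' v, map_sum]
    simp only [map_smul]
  rw [hG.expand e v, hlin, hBv, hG.sum]
  exact Finset.sum_congr rfl fun i _ => by rw [h, hG.smul]

/-- Anticommutators with the `G (e j)` recover the real coordinates of `w`, so the complex factor
can be replaced by its real part. -/
theorem exists_real_eigenvalue [Nontrivial A] (hG : IsCliffordMap G)
    (e : OrthonormalBasis (Fin n) ℝ V) {w : V} {i : Fin n} {z : ℂ}
    (h : G w = z • G (e i)) : w = z.re • e i := by
  have hj : ∀ j, ((inner ℝ w (e j) : ℝ) : ℂ) = z * (if i = j then 1 else 0) := fun j => by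
    have h1 := hG.anticomm w (e j)
    have h2 := hG.anticomm (e i) (e j)
    rw [h, smul_mul_assoc, mul_smul_comm, ← smul_add, h2, smul_smul, ← sub_eq_zero,
      ← sub_smul] at h1
    have h3 := (smul_eq_zero.1 h1).resolve_right one_ne_zero
    have h4 : inner ℝ (e i) (e j) = if i = j then (1 : ℝ) else 0 := e.inner_eq_ite i j
    rw [h4] at h3
    split_ifs at h3 ⊢ <;> push_cast at h3 <;> linear_combination (1 / 2) * h3
  have hr : ∀ j, inner ℝ (e j) w = if i = j then z.re else 0 := fun j => by
    rw [real_inner_comm]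
    have := congrArg Complex.re (hj j)
    rw [Complex.ofReal_re] at this
    rw [this]; split_ifs <;> simp
  rw [← e.sum_repr' w]
  simp only [hr, ite_smul, zero_smul, Finset.sum_ite_eq, Finset.mem_univ, if_true]

theorem eq_ofReal_of_eq_smul [Nontrivial A] (hG : IsCliffordMap G)
    (e : OrthonormalBasis (Fin n) ℝ V) {i : Fin n} {B : V →ₗ[ℝ] V} {a b : A} {z : ℂ}
    (hp : IsPairFor G B a b) (h : qMap a b (G (e i)) = z • G (e i)) :
    B (e i) = z.re • e i :=
  hG.exists_real_eigenvalue e (by rw [← hp.2, h])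

/-- The symmetric part of `Ω` is the commutator of `d` with `vw + wv`, which is scalar. -/
theorem omega_swap (hG : IsCliffordMap G) (c d : A) (v w : V) :
    Omega G c d w v = -Omega G c d v w := by
  have h : Omega G c d w v + Omega G c d v w =
      d * (G v * G w + G w * G v) - (G v * G w + G w * G v) * d := by
    simp only [Omega, sMap]; noncomm_ring
  rw [hG.anticomm, mul_smul_comm, smul_mul_assoc, mul_one, one_mul, sub_self] at h
  exact eq_neg_of_add_eq_zero_left h

theorem omega_expand (hG : IsCliffordMap G) (e : OrthonormalBasis (Fin n) ℝ V) (c d : A)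
    (v w : V) : Omega G c d v w =
      ∑ i, ∑ j, (((inner ℝ (e i) v : ℝ) : ℂ) * ((inner ℝ (e j) w : ℝ) : ℂ)) •
        Omega G c d (e i) (e j) := by
  let F : A →ₗ[ℂ] A →ₗ[ℂ] A := LinearMap.mk₂ ℂ (fun u w => sMap d c u * w + w * sMap c d u)
    (fun _ _ _ => by simp only [sMap]; noncomm_ring)
    (fun z _ _ => by
      simp only [sMap, mul_smul_comm, smul_mul_assoc, ← smul_sub, ← smul_add])
    (fun _ _ _ => by simp only [sMap]; noncomm_ring)
    (fun z _ _ => by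
      simp only [mul_smul_comm, smul_mul_assoc, ← smul_add])
  change F (G v) (G w) = ∑ i, ∑ j, _ • F (G (e i)) (G (e j))
  conv_lhs => rw [hG.expand e v, hG.expand e w]
  simp only [map_sum, LinearMap.sum_apply, map_smul, LinearMap.smul_apply, Finset.smul_sum,
    smul_smul]
  rw [Finset.sum_comm]
  exact Finset.sum_congr rfl fun i _ => Finset.sum_congr rfl fun j _ => by rw [mul_comm]

/-- `Ω_{c,d}` lies in `so_B(V) ⊗ A` if and only if it vanishes on pairs of eigenvectors with
different eigenvalues. -/
theorem omega_mem_iff (hG : IsCliffordMap G) (e : OrthonormalBasis (Fin n) ℝ V)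
    {B : V →ₗ[ℝ] V} (hB : B.IsSymmetric) {l : Fin n → ℝ} (hl : ∀ i, B (e i) = l i • e i)
    (c d : A) : Omega G c d ∈ soBTensor A B ↔
      ∀ i j, l i ≠ l j → Omega G c d (e i) (e j) = 0 := by
  constructor
  · intro hΩ i j hij
    suffices h : ∀ T ∈ soBTensor A B, T (e i) (e j) = 0 from h _ hΩ
    intro T hT
    induction hT using Submodule.span_induction with
    | mem T hT =>
      obtain ⟨D, hD, x, rfl⟩ := hT
      have h1 : inner ℝ (D (B (e i))) (e j) = inner ℝ (D (e i)) (B (e j)) := by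
        have := congrArg (fun F : V →ₗ[ℝ] V => F (e i)) hD.2
        simp only [LinearMap.comp_apply] at this
        rw [this, hB]
      rw [hl, hl, map_smul, real_inner_smul_left, real_inner_smul_right] at h1
      have h2 : inner ℝ (D (e i)) (e j) = 0 := by
        have : (l i - l j) * inner ℝ (D (e i)) (e j) = 0 := by linear_combination h1
        exact (mul_eq_zero.1 this).resolve_left (sub_ne_zero.2 hij)
      simp [h2]
    | zero => rfl
    | add T T' _ _ h h' => simp [h, h']
    | smul z T _ h => simp [h]
  · intro h
    -- By antisymmetry `Ω` is half the sum of the tensors `wedgeEnd (e i) (e j) ⊗ Ω(e i, e j)`; a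
    -- nonzero term has both vectors in one eigenspace.
    have hΩ : Omega G c d = ∑ i, ∑ j, (2⁻¹ : ℂ) • fun v w =>
        ((inner ℝ (wedgeEnd (e i) (e j) v) w : ℝ) : ℂ) • Omega G c d (e i) (e j) := by
      funext v w
      have hsw : ∑ i, ∑ j, (((inner ℝ (e j) v : ℝ) : ℂ) * ((inner ℝ (e i) w : ℝ) : ℂ)) •
          Omega G c d (e i) (e j) = -Omega G c d v w := by
        rw [Finset.sum_comm, hG.omega_expand e c d v w, ← Finset.sum_neg_distrib]
        refine Finset.sum_congr rfl fun i _ => ?_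
        rw [← Finset.sum_neg_distrib]
        refine Finset.sum_congr rfl fun j _ => ?_
        rw [hG.omega_swap c d (e i) (e j), smul_neg]
      have hsum : (2⁻¹ : ℂ) • (Omega G c d v w - -Omega G c d v w) = Omega G c d v w := by
        module
      rw [← hsum, ← hsw]
      conv_lhs => rw [hG.omega_expand e c d v w]
      simp only [Finset.sum_apply, Pi.smul_apply, ← Finset.sum_sub_distrib, Finset.smul_sum]
      refine Finset.sum_congr rfl fun i _ => Finset.sum_congr rfl fun j _ => ?_
      rw [← sub_smul, wedgeEnd_apply, inner_sub_left, real_inner_smul_left, real_inner_smul_left]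
      push_cast
      rfl
    rw [hΩ]
    refine Submodule.sum_mem _ fun i _ => Submodule.sum_mem _ fun j _ =>
      Submodule.smul_mem _ _ ?_
    by_cases hij : l i = l j
    · exact Submodule.subset_span ⟨_, wedgeEnd_mem_soB hB (hl i) (by rw [hl j, hij]), _, rfl⟩
    · rw [h i j hij]
      simp only [smul_zero]
      exact Submodule.zero_mem _

/-- The rotation generator of the plane of `e i` and `e j` commutes with `B`, and its spin element
is half of `G (e i) * G (e j)`. Commuting with this product equates the two conjugates. -/
theorem twist_eq_of_isInvariant [FiniteDimensional ℝ V] (hG : IsCliffordMap G)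
    (e : OrthonormalBasis (Fin n) ℝ V) {B : V →ₗ[ℝ] V} (hB : B.IsSymmetric) {l : Fin n → ℝ}
    (hl : ∀ i, B (e i) = l i • e i) {c : A} (hc : IsInvariant G B c) {i j : Fin n}
    (hij : l i = l j) : twist (G (e i)) c = twist (G (e j)) c := by
  by_cases hne : i = j
  · rw [hne]
  have hg := hG.isGammaSystem e
  have hspin : spinElement G (wedgeEnd (e i) (e j)) = (2⁻¹ : ℂ) • (G (e i) * G (e j)) := by
    have h1 : ∀ x y : V, ∑ k, G (stdOrthonormalBasis ℝ V k) *
        ((((inner ℝ x (stdOrthonormalBasis ℝ V k) : ℝ) : ℂ)) • G y) = G x * G y := fun x y => by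
      rw [hG.expand (stdOrthonormalBasis ℝ V) x, Finset.sum_mul]
      refine Finset.sum_congr rfl fun k _ => ?_
      rw [real_inner_comm, mul_smul_comm, smul_mul_assoc]
    have h2 : ∀ v, G (wedgeEnd (e i) (e j) v) =
        ((inner ℝ (e i) v : ℝ) : ℂ) • G (e j) - ((inner ℝ (e j) v : ℝ) : ℂ) • G (e i) :=
      fun v => by
      rw [wedgeEnd_apply, sub_eq_add_neg, ← neg_smul, hG.add, hG.smul, hG.smul]
      push_cast
      rw [neg_smul, sub_eq_add_neg]
    rw [spinElement]
    simp only [h2, mul_sub, Finset.sum_sub_distrib, h1]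
    have h3 : G (e j) * G (e i) = -(G (e i) * G (e j)) := hg.anti j i (Ne.symm hne)
    rw [h3]
    module
  have h := hc _ (wedgeEnd_mem_soB hB (hl i) (by rw [hl j, hij]))
  rw [hspin, smul_mul_assoc, mul_smul_comm] at h
  have h' : G (e i) * G (e j) * c = c * (G (e i) * G (e j)) := by
    have := congrArg (fun z => (2 : ℂ) • z) h
    simpa [smul_smul] using this
  have hi : G (e i) * G (e i) = -1 := hg.sq i
  have hj : G (e j) * G (e j) = -1 := hg.sq j
  have e1 : twist (G (e j)) c = G (e i) * (G (e i) * G (e j) * c) * G (e j) := by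
    have : G (e i) * (G (e i) * G (e j) * c) * G (e j) =
        (G (e i) * G (e i)) * (G (e j) * c * G (e j)) := by simp only [mul_assoc]
    rw [this, hi, twist_apply, neg_one_mul]
  have e2 : twist (G (e i)) c = G (e i) * (c * (G (e i) * G (e j))) * G (e j) := by
    have : G (e i) * (c * (G (e i) * G (e j))) * G (e j) =
        (G (e i) * c * G (e i)) * (G (e j) * G (e j)) := by simp only [mul_assoc]
    rw [this, hj, twist_apply, mul_neg_one]
  rw [e1, e2, h']

end IsCliffordMap

/-! ### Eigenvalues and multiplicities from an eigenbasis -/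

/-- The eigenvalues of a diagonalized endomorphism. -/
theorem hasEigenvalue_iff_exists {B : V →ₗ[ℝ] V} (hB : B.IsSymmetric)
    (e : OrthonormalBasis (Fin n) ℝ V) {l : Fin n → ℝ} (hl : ∀ i, B (e i) = l i • e i) (r : ℝ) :
    Module.End.HasEigenvalue B r ↔ ∃ i, l i = r := by
  constructor
  · intro h
    obtain ⟨v, hv⟩ := h.exists_hasEigenvector
    have hBv := hv.apply_eq_smul
    by_contra! hne
    refine hv.2 ?_
    rw [← e.sum_repr' v]
    refine Finset.sum_eq_zero fun i _ => ?_
    have h1 : inner ℝ (B (e i)) v = inner ℝ (e i) (B v) := hB _ _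
    rw [hl, hBv, real_inner_smul_left, real_inner_smul_right] at h1
    have : (l i - r) * inner ℝ (e i) v = 0 := by linear_combination h1
    rw [(mul_eq_zero.1 this).resolve_left (sub_ne_zero.2 (hne i)), zero_smul]
  · rintro ⟨i, rfl⟩
    exact Module.End.hasEigenvalue_of_hasEigenvector (x := e i)
      ⟨Module.End.mem_eigenspace_iff.2 (hl i), e.orthonormal.ne_zero i⟩

theorem finrank_eigenspace {B : V →ₗ[ℝ] V} (hB : B.IsSymmetric)
    (e : OrthonormalBasis (Fin n) ℝ V) {l : Fin n → ℝ} (hl : ∀ i, B (e i) = l i • e i) (r : ℝ) :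
    Module.finrank ℝ (Module.End.eigenspace B r) =
      (Finset.univ.filter fun i => l i = r).card := by
  have hspan : Module.End.eigenspace B r =
      Submodule.span ℝ (Set.range fun i : {i // l i = r} => e i) := by
    apply le_antisymm
    · intro v hv
      rw [Module.End.mem_eigenspace_iff] at hv
      rw [← e.sum_repr' v]
      refine Submodule.sum_mem _ fun i _ => ?_
      by_cases hi : l i = r
      · exact Submodule.smul_mem _ _ (Submodule.subset_span ⟨⟨i, hi⟩, rfl⟩)
      · have h1 : inner ℝ (B (e i)) v = inner ℝ (e i) (B v) := hB _ _
        rw [hl, hv, real_inner_smul_left, real_inner_smul_right] at h1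
        have : (l i - r) * inner ℝ (e i) v = 0 := by linear_combination h1
        rw [(mul_eq_zero.1 this).resolve_left (sub_ne_zero.2 hi), zero_smul]
        exact Submodule.zero_mem _
    · rw [Submodule.span_le]
      rintro _ ⟨⟨i, hi⟩, rfl⟩
      exact Module.End.mem_eigenspace_iff.2 (by rw [hl, hi])
  rw [hspan, finrank_span_eq_card, Fintype.card_subtype]
  exact e.orthonormal.linearIndependent.comp _ Subtype.val_injective

end CliffordPair

/-! ### The cases of one, two and more eigenvalues -/

namespace CliffordPair

variable {V A : Type*} [NormedAddCommGroup V] [InnerProductSpace ℝ V] [Ring A] [Algebra ℂ A]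
  {n m : ℕ} {G : V → A} {B : V →ₗ[ℝ] V} {c d : A}

theorem gammaProd_eq_blade {V A : Type*} [NormedAddCommGroup V] [InnerProductSpace ℝ V] [Ring A]
    {n : ℕ} {G : V → A} (e : OrthonormalBasis (Fin n) ℝ V) (I : Finset (Fin n)) :
    gammaProd G e I = blade (fun i => G (e i)) I := rfl

theorem gammaStar_eq_bladeStar (e : OrthonormalBasis (Fin n) ℝ V) :
    gammaStar G e = bladeStar fun i => G (e i) := rfl

namespace IsCliffordMap

theorem isPairFor_of_add_trivial (hG : IsCliffordMap G) (e : OrthonormalBasis (Fin n) ℝ V)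
    {a b : A} {t s : ℂ} (hpair : IsPairFor G B c d)
    (hc : c = a + (t • 1 + s • bladeStar fun i => G (e i)))
    (hd : d = b + (t • 1 - ((-1) ^ n * s) • bladeStar fun i => G (e i)))
    (h : ∀ i, Commute (t • 1 + s • bladeStar fun i => G (e i))
      (half (fun i => G (e i)) a b i)) : IsPairFor G B a b := by
  refine hG.isPairFor_of_basis e hpair.1 fun i => ?_
  rw [← hpair.2, hc, hd]
  exact ((hG.isGammaSystem e).qMap_gen_eq_of_commute (h i)).symm

theorem omega_mem_of_half (hG : IsCliffordMap G) (e : OrthonormalBasis (Fin n) ℝ V)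
    (hB : B.IsSymmetric) {l : Fin n → ℝ} (hl : ∀ i, B (e i) = l i • e i)
    (h : ∀ i j, l i ≠ l j → ∃ (I : Finset (Fin n)) (x y : ℂ), i ∈ I ∧ j ∉ I ∧
      (Odd n → y = 0) ∧ half (fun i => G (e i)) c d i = mono (fun i => G (e i)) I x y) :
    Omega G c d ∈ soBTensor A B := by
  rw [hG.omega_mem_iff e hB hl]
  intro i j hij
  obtain ⟨I, x, y, hi, hj, hy, hxy⟩ := h i j hij
  exact (hG.isGammaSystem e).omega_gen_eq_zero_of_half hi hj hy hxy

/-- Here both sides hold for every invariant pair: there are no distinct eigenvalues to test `Ω` on,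
and all conjugates of `c` and of `d` agree. -/
theorem omega_mem_iff_of_scalar [Nontrivial A] [FiniteDimensional ℝ V] (hG : IsCliffordMap G)
    (e₀ : OrthonormalBasis (Fin n) ℝ V) {r : ℝ} (hBr : B = r • LinearMap.id)
    (hpair : IsPairFor G B c d) (hc : IsInvariant G B c) (hd : IsInvariant G B d) :
    Omega G c d ∈ soBTensor A B ↔ ∃ (e : OrthonormalBasis (Fin n) ℝ V) (a b : A),
      EqUpToTrivial G e c d a b ∧ IsPairFor G B a b ∧
      (IsScalarPair a b ∨ IsPseudoScalarPair G e a b) := by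
  have hl : ∀ (e : OrthonormalBasis (Fin n) ℝ V) i, B (e i) = r • e i := fun e i => by
    rw [hBr]; rfl
  constructor
  · intro _
    have hg := hG.isGammaSystem e₀
    have htw : ∀ {x : A}, IsInvariant G B x → ∀ i j,
        twist (G (e₀ i)) x = twist (G (e₀ j)) x := fun hx i j =>
      hG.twist_eq_of_isInvariant e₀ hpair.1 (l := fun _ => r) (hl e₀) hx rfl
    by_cases hcase : Even n ∧ 0 < n
    · obtain ⟨he, hn⟩ := hcase
      have hodd : ∀ {z : ℂ}, Odd n → z = 0 := fun ho => absurd he (Nat.not_even_iff_odd.2 ho)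
      obtain ⟨c0, c1, hc01, -⟩ := hg.exists_add_bladeStar c (htw hc)
      obtain ⟨d0, d1, hd01, -⟩ := hg.exists_add_bladeStar d (htw hd)
      have hhalf : ∀ i, half (fun i => G (e₀ i)) c d i =
          bladeLin (fun i => G (e₀ i)) (2⁻¹ * (c0 - d0)) (2⁻¹ * (c1 + d1)) := fun i => by
        have h1 : twist (G (e₀ i)) d = bladeLin (fun i => G (e₀ i)) d0 (-d1) := by
          rw [hd01]; exact hg.twist_bladeLin i hodd
        rw [half, h1, hc01, bladeLin, bladeLin]; module
      have hcomm : ∀ t s u v : ℂ, Commute (t • 1 + s • bladeStar fun i => G (e₀ i))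
          (bladeLin (fun i => G (e₀ i)) u v) := fun t s u v => by
        have : bladeLin (fun i => G (e₀ i)) t s * bladeLin (fun i => G (e₀ i)) u v =
            bladeLin (fun i => G (e₀ i)) u v * bladeLin (fun i => G (e₀ i)) t s := by
          rw [hg.bladeLin_mul, hg.bladeLin_mul]; congr 1 <;> ring
        exact this
      -- The `Γ^*`-coefficient of `4 X²`. If the first factor vanishes the scalar part is trivial,
      -- otherwise the pseudo-scalar part is.
      have hprod : (c0 - d0) * (c1 + d1) = 0 := by
        have hq := hpair.2 (e₀ ⟨0, hn⟩)
        rw [hl, hG.smul] at hq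
        have h1 := (hg.qMap_gen_eq_iff c d ⟨0, hn⟩ r).1 hq
        have h2 : c * half (fun i => G (e₀ i)) c d ⟨0, hn⟩ =
            half (fun i => G (e₀ i)) c d ⟨0, hn⟩ * c := by
          rw [hhalf, hc01]; exact hcomm _ _ _ _
        rw [h2, sub_self, smul_zero, add_zero, hhalf, hg.bladeLin_mul, bladeLin, smul_add,
          smul_smul, smul_smul, ← sub_eq_zero, add_sub_right_comm, ← sub_smul] at h1
        have h3 := (hg.bladeLin_eq_zero ⟨0, hn⟩ hodd h1).2
        linear_combination h3 / 2
      have hsign : (-1 : ℂ) ^ n = 1 := he.neg_one_pow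
      rcases mul_eq_zero.1 hprod with h0 | h0
      · have e1 : c = c1 • bladeStar (fun i => G (e₀ i)) +
            (c0 • 1 + (0 : ℂ) • bladeStar fun i => G (e₀ i)) := by rw [hc01]; module
        have e2 : d = d1 • bladeStar (fun i => G (e₀ i)) +
            (c0 • 1 - ((-1) ^ n * (0 : ℂ)) • bladeStar fun i => G (e₀ i)) := by
          rw [hd01, sub_eq_zero.1 h0]; module
        refine ⟨e₀, _, _, ⟨c0, 0, e1, e2⟩, ?_, Or.inr ⟨c1, d1, rfl, rfl⟩⟩
        refine hG.isPairFor_of_add_trivial e₀ hpair e1 e2 fun i => ?_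
        rw [← hg.half_add_trivial _ _ c0 0, ← e1, ← e2, hhalf]
        exact hcomm _ _ _ _
      · have hd1 : d1 = -c1 := by linear_combination h0
        have e1 : c = c0 • 1 + ((0 : ℂ) • 1 + c1 • bladeStar fun i => G (e₀ i)) := by
          rw [hc01]; module
        have e2 : d = d0 • 1 + ((0 : ℂ) • 1 -
            ((-1) ^ n * c1) • bladeStar fun i => G (e₀ i)) := by
          rw [hd01, hd1, hsign]; module
        refine ⟨e₀, _, _, ⟨0, c1, e1, e2⟩, ?_, Or.inl ⟨c0, d0, rfl, rfl⟩⟩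
        refine hG.isPairFor_of_add_trivial e₀ hpair e1 e2 fun i => ?_
        rw [← hg.half_add_trivial _ _ 0 c1, ← e1, ← e2, hhalf]
        exact hcomm _ _ _ _
    -- In odd or zero dimension only scalars remain.
    · have hsc : ∀ x : A, IsInvariant G B x → ∃ z : ℂ, x = z • 1 := fun x hx => by
        rcases Nat.eq_zero_or_pos n with h0 | h0
        · exact hg.exists_smul_one x fun i => absurd i.pos (by omega)
        · obtain ⟨z, w, hzw, hw⟩ := hg.exists_add_bladeStar x (htw hx)
          have ho : Odd n := by
            rw [← Nat.not_even_iff_odd]; exact fun he => hcase ⟨he, h0⟩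
          exact ⟨z, by rw [hzw, hw ho]; simp⟩
      obtain ⟨z, hz⟩ := hsc c hc
      obtain ⟨w, hw⟩ := hsc d hd
      exact ⟨e₀, c, d, ⟨0, 0, by simp, by simp⟩, hpair, Or.inl ⟨z, w, hz, hw⟩⟩
  · intro _
    rw [hG.omega_mem_iff e₀ hpair.1 (l := fun _ => r) (hl e₀)]
    exact fun i j hij => absurd rfl hij

/-- The block form of an invariant pair with `Ω` in `so_B(V) ⊗ A`, if `B` has at least two
eigenvalues. -/
theorem exists_blockSum_of_omega_mem [FiniteDimensional ℝ V]
    (hG : IsCliffordMap G) (e : OrthonormalBasis (Fin n) ℝ V) {p : Fin n → Fin m}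
    {I : Fin m → Finset (Fin n)} (hI : ∀ i α, i ∈ I α ↔ p i = α) (hp : Function.Surjective p)
    (hm : 2 ≤ m) {l : Fin m → ℝ} (hl : Function.Injective l)
    (hBl : ∀ i, B (e i) = l (p i) • e i) (hpair : IsPairFor G B c d) (hc : IsInvariant G B c)
    (hd : IsInvariant G B d) (hΩ : Omega G c d ∈ soBTensor A B) :
    ∃ x y : Fin m → ℂ, (Odd n → y = 0) ∧
      EqUpToTrivial G e c d (blockSum (fun i => G (e i)) I x y)
        (blockSumBar (fun i => G (e i)) I x y) ∧
      IsPairFor G B (blockSum (fun i => G (e i)) I x y) (blockSumBar (fun i => G (e i)) I x y) ∧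
      (2 < m → (∀ α, (4 : ℂ) • (mono (fun i => G (e i)) (I α) (x α) (y α) *
          mono (fun i => G (e i)) (I α) (x α) (y α)) = (l α : ℂ) • 1) ∧
        ∀ α β, α ≠ β → Commute (mono (fun i => G (e i)) (I α) (x α) (y α))
          (mono (fun i => G (e i)) (I β) (x β) (y β))) := by
  have hg := hG.isGammaSystem e
  have hΩ' := (hG.omega_mem_iff e hpair.1 hBl c d).1 hΩ
  obtain ⟨x, y, t, s, hy, -, e1, e2⟩ := hg.exists_blockSum (c := c) (d := d) hI hp (by omega)
    (fun i j hij => hG.twist_eq_of_isInvariant e hpair.1 hBl hc (by rw [hij]))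
    (fun i j hij => hG.twist_eq_of_isInvariant e hpair.1 hBl hd (by rw [hij]))
    fun i j hij => (hg.omega_gen_eq_zero_iff c d (fun h => hij (by rw [h]))).1
      (hΩ' i j fun h => hij (hl h))
  have hhalf : ∀ i, half (fun i => G (e i)) c d i =
      mono (fun i => G (e i)) (I (p i)) (x (p i)) (y (p i)) := fun i => by
    rw [e1, e2, hg.half_add_trivial, hg.half_blockSum hI hy]
  have hq : ∀ α, (4 : ℂ) • (mono (fun i => G (e i)) (I α) (x α) (y α) *
        mono (fun i => G (e i)) (I α) (x α) (y α)) +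
      (2 : ℂ) • ((blockSum (fun i => G (e i)) I x y +
          (t • 1 + s • bladeStar fun i => G (e i))) * mono (fun i => G (e i)) (I α) (x α) (y α) -
        mono (fun i => G (e i)) (I α) (x α) (y α) * (blockSum (fun i => G (e i)) I x y +
          (t • 1 + s • bladeStar fun i => G (e i)))) = (l α : ℂ) • 1 := fun α => by
    obtain ⟨i, rfl⟩ := hp α
    have h1 := hpair.2 (e i)
    rw [hBl, hG.smul] at h1
    have h2 := (hg.qMap_gen_eq_iff c d i _).1 h1
    rwa [hhalf, e1] at h2
  refine ⟨x, y, hy, ⟨t, s, e1, e2⟩, ?_, fun hm3 =>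
    ⟨fun α => hg.mono_sq_of_quadratic hI hp hm3 hy hq α, fun α β hαβ =>
      hg.commute_mono hI hp hm3 hy hq hαβ⟩⟩
  refine hG.isPairFor_of_add_trivial e hpair e1 e2 fun i => ?_
  rw [hg.half_blockSum hI hy]
  exact hg.commute_trivial hI hp hm hy hq (p i)

end IsCliffordMap

/-- The blocks of equal values of a function. -/
theorem exists_block_labels (l₀ : Fin n → ℝ) :
    ∃ (m : ℕ) (p : Fin n → Fin m) (l : Fin m → ℝ), Function.Surjective p ∧
      Function.Injective l ∧ (∀ i, l₀ i = l (p i)) ∧ m = (Set.range l₀).ncard := by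
  classical
  let E := (Finset.univ.image l₀).equivFin
  refine ⟨_, fun i => E ⟨l₀ i, Finset.mem_image_of_mem _ (Finset.mem_univ i)⟩,
    fun α => (E.symm α : ℝ), fun α => ?_, fun α β h => ?_, fun i => by simp, ?_⟩
  · obtain ⟨i, -, hi⟩ := Finset.mem_image.1 (E.symm α).2
    exact ⟨i, E.eq_symm_apply.1 (Subtype.ext hi)⟩
  · exact E.symm.injective (Subtype.ext h)
  · rw [← Set.ncard_coe_finset]; simp

namespace IsCliffordMap

/-- Pairs of pseudo-monomials with a common index set are of monomial or pseudo-monomial shape. -/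
theorem exists_monomial_shape [Nontrivial A] (hG : IsCliffordMap G)
    (e : OrthonormalBasis (Fin n) ℝ V) {I : Finset (Fin n)} {i j : Fin n} (hi : i ∈ I)
    (hj : j ∉ I) {x y x' y' l l' : ℂ} (hy : Odd n → y = 0) (hy' : Odd n → y' = 0)
    (hqi : qMap (mono (fun i => G (e i)) I x y) (mono (fun i => G (e i)) I x' y') (G (e i)) =
      l • G (e i))
    (hqj : qMap (mono (fun i => G (e i)) I x y) (mono (fun i => G (e i)) I x' y') (G (e j)) =
      l' • G (e j)) :
    ∃ J, IsMonomial G e J (mono (fun i => G (e i)) I x y) (mono (fun i => G (e i)) I x' y') ∨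
      IsPseudoMonomial G e J (mono (fun i => G (e i)) I x y)
        (mono (fun i => G (e i)) I x' y') := by
  have hg := hG.isGammaSystem e
  have hmono : y = 0 → y' = 0 → IsMonomial G e I (mono (fun i => G (e i)) I x y)
      (mono (fun i => G (e i)) I x' y') := fun h h' => by
    rw [h, h']; exact ⟨x, x', mono_zero_right _ _ _, mono_zero_right _ _ _⟩
  rcases n.even_or_odd with he | ho
  · have h1 := hg.qMap_mono_eq_iff I hy hy' i rfl hqi
    have h2 := hg.qMap_mono_eq_iff I hy hy' j rfl hqj
    rw [if_pos hi] at h1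
    rw [if_neg hj] at h2
    have hne : I.Nonempty := ⟨i, hi⟩
    have hun : I ≠ Finset.univ := fun h => hj (h ▸ Finset.mem_univ j)
    rcases I.card.even_or_odd with hk | hk
    · rw [hk.neg_one_pow] at h1 h2
      have h3 : (x + x') * (y - y') = 0 := by linear_combination h1 / 2
      have h4 : (x - x') * (y + y') = 0 := by linear_combination h2 / 2
      rcases mul_eq_zero.1 h3 with h3 | h3 <;> rcases mul_eq_zero.1 h4 with h4 | h4
      -- Only the `Γ^* Γ_I` terms survive, and these are monomials over the complement.
      · have hx : x = 0 := by linear_combination (h3 + h4) / 2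
        have hx' : x' = 0 := by linear_combination (h3 - h4) / 2
        obtain ⟨z, hz⟩ := hg.exists_bladeStar_mul_blade he I
        have h5 : ∀ w : ℂ, mono (fun i => G (e i)) I 0 w = (w * z) • gammaProd G e Iᶜ := fun w => by
          rw [mono, bladeLin, zero_smul, zero_add, smul_mul_assoc, hz, smul_smul]; rfl
        exact ⟨Iᶜ, Or.inl ⟨y * z, y' * z, by rw [hx, h5], by rw [hx', h5]⟩⟩
      · refine ⟨I, Or.inr ⟨he, hne, hun, Or.inl ⟨hk, x, y, rfl, Or.inr ?_⟩⟩⟩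
        rw [eq_neg_of_add_eq_zero_right h3, eq_neg_of_add_eq_zero_right h4, mono, mono, bladeLin,
          bladeLin, ← neg_mul]
        congr 1; module
      · refine ⟨I, Or.inr ⟨he, hne, hun, Or.inl ⟨hk, x, y, rfl, Or.inl ?_⟩⟩⟩
        rw [sub_eq_zero.1 h3, sub_eq_zero.1 h4]
      · have hy0 : y = 0 := by linear_combination (h3 + h4) / 2
        have hy0' : y' = 0 := by linear_combination (h4 - h3) / 2
        exact ⟨I, Or.inl (hmono hy0 hy0')⟩
    · rw [hk.neg_one_pow] at h1
      obtain ⟨r, r', φ, ψ, ⟨hx, hy⟩, hx', hy'⟩ :=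
        exists_polar_pair_conj (a := x) (b := y) (c := x') (d := y') (by
          linear_combination -h1 / 2)
      refine ⟨I, Or.inr ⟨he, hne, hun, Or.inr ⟨hk, r, r', φ, ψ, ?_, ?_⟩⟩⟩
      · rw [hx, hy, ← smul_mono, mono, bladeLin]; rfl
      · rw [hx', hy', ← smul_mono, mono, bladeLin, neg_smul, ← sub_eq_add_neg]; rfl
  · exact ⟨I, Or.inl (hmono (hy ho) (hy' ho))⟩

/-- The two values of `η` are the signs for indices inside and outside `I`; the final equation kills
the `Γ^*`-term of `qMap_mono`, so every `G (e i)` is an eigenvector. -/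
theorem exists_mono_of_shape (e : OrthonormalBasis (Fin n) ℝ V) {I : Finset (Fin n)} {a b : A}
    (h : IsMonomial G e I a b ∨ IsPseudoMonomial G e I a b) :
    ∃ x y x' y' : ℂ, a = mono (fun i => G (e i)) I x y ∧ b = mono (fun i => G (e i)) I x' y' ∧
      (Odd n → y = 0) ∧ (Odd n → y' = 0) ∧
      ∀ η : ℂ, (η = (-1) ^ I.card ∨ η = -(-1) ^ I.card) →
        ((-1) ^ I.card + 1) * ((x - η * x') * (y + η * y')) +
          ((-1) ^ I.card - 1) * (η * (x * y' + y * x')) = 0 := by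
  rcases h with ⟨α, β, ha, hb⟩ | ⟨he, -, -, h⟩
  · exact ⟨α, 0, β, 0, by rw [ha, mono_zero_right]; rfl, by rw [hb, mono_zero_right]; rfl,
      fun _ => rfl, fun _ => rfl, fun η _ => by ring⟩
  · have hodd : ∀ {z : ℂ}, Odd n → z = 0 := fun ho => absurd he (Nat.not_even_iff_odd.2 ho)
    rcases h with ⟨hk, α, β, ha, hb⟩ | ⟨hk, α, β, φ, ψ, ha, hb⟩
    · rcases hb with hb | hb
      · refine ⟨α, β, α, β, ha, hb.trans ha, hodd, hodd, fun η hη => ?_⟩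
        rw [hk.neg_one_pow] at hη ⊢
        rcases hη with rfl | rfl <;> ring
      · refine ⟨α, β, -α, -β, ha, ?_, hodd, hodd, fun η hη => ?_⟩
        · rw [hb, ha, mono, bladeLin, ← neg_mul, neg_add, neg_smul, neg_smul]; rfl
        · rw [hk.neg_one_pow] at hη ⊢
          rcases hη with rfl | rfl <;> ring
    · refine ⟨α * ((Real.cos φ : ℂ) * Complex.exp (Complex.I * ψ)), α * (Real.sin φ : ℂ),
        β * ((Real.cos φ : ℂ) * Complex.exp (Complex.I * ψ)), β * -(Real.sin φ : ℂ), ?_, ?_,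
        hodd, hodd, fun η hη => ?_⟩
      · rw [ha, ← smul_mono, mono, bladeLin]; rfl
      · rw [hb, ← smul_mono, mono, bladeLin, neg_smul, ← sub_eq_add_neg]; rfl
      · rw [hk.neg_one_pow]; ring

theorem omega_mem_iff_of_two [Nontrivial A] [FiniteDimensional ℝ V] (hG : IsCliffordMap G)
    (e₀ : OrthonormalBasis (Fin n) ℝ V) {l₀ : Fin n → ℝ} (hl₀ : ∀ i, B (e₀ i) = l₀ i • e₀ i)
    (hcard : (Set.range l₀).ncard = 2)
    (hpair : IsPairFor G B c d) (hc : IsInvariant G B c) (hd : IsInvariant G B d) :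
    Omega G c d ∈ soBTensor A B ↔
      ∃ (e : OrthonormalBasis (Fin n) ℝ V) (I : Finset (Fin n)) (a b : A),
        EqUpToTrivial G e c d a b ∧ IsPairFor G B a b ∧
        (IsMonomial G e I a b ∨ IsPseudoMonomial G e I a b) := by
  constructor
  · intro hΩ
    obtain ⟨m, p, l, hp, hl, hlp, hm⟩ := exists_block_labels l₀
    obtain rfl : m = 2 := hm.trans hcard
    set I : Fin 2 → Finset (Fin n) := fun α => Finset.univ.filter fun i => p i = α with hIdef
    have hI : ∀ i α, i ∈ I α ↔ p i = α := fun i α => by simp [hIdef]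
    have hI1 : I 1 = (I 0)ᶜ := by
      ext i; rw [Finset.mem_compl, hI, hI]; omega
    have hg := hG.isGammaSystem e₀
    have hBl : ∀ i, B (e₀ i) = l (p i) • e₀ i := fun i => by rw [hl₀, hlp]
    obtain ⟨x, y, hy, htriv, hpair', -⟩ :=
      hG.exists_blockSum_of_omega_mem e₀ hI hp le_rfl hl hBl hpair hc hd hΩ
    have hyα : ∀ α, Odd n → y α = 0 := fun α ho => by rw [hy ho]; rfl
    obtain ⟨u, v, huv, hv⟩ := hg.exists_mono_compl (I 0) (x := x 1) (hyα 1)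
    obtain ⟨u', v', huv', hv'⟩ := hg.exists_mono_compl (I 0) (x := x 1) (y := -y 1)
      (fun ho => by rw [hyα 1 ho, neg_zero])
    have ha : blockSum (fun i => G (e₀ i)) I x y =
        mono (fun i => G (e₀ i)) (I 0) (x 0 + u) (y 0 + v) := by
      rw [blockSum, Fin.sum_univ_two, hI1, huv, mono_add]
    have hb : blockSumBar (fun i => G (e₀ i)) I x y = mono (fun i => G (e₀ i)) (I 0)
        ((-1) ^ (I 0).card * x 0 + (-1) ^ (I 1).card * u')
        ((-1) ^ (I 0).card * -y 0 + (-1) ^ (I 1).card * v') := by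
      rw [← hI1] at huv'
      rw [blockSumBar, Fin.sum_univ_two, huv', smul_mono, smul_mono, mono_add]
    obtain ⟨i, hi⟩ := hp 0
    obtain ⟨j, hj⟩ := hp 1
    have hq : ∀ i, qMap (blockSum (fun i => G (e₀ i)) I x y)
        (blockSumBar (fun i => G (e₀ i)) I x y) (G (e₀ i)) = (l (p i) : ℂ) • G (e₀ i) :=
      fun i => by rw [hpair'.2, hBl, hG.smul]
    have hqi := hq i
    have hqj := hq j
    rw [ha, hb] at hqi hqj htriv hpair'
    obtain ⟨J, hJ⟩ := hG.exists_monomial_shape e₀ ((hI i 0).2 hi)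
      (fun h => by rw [hI, hj] at h; exact one_ne_zero h)
      (fun ho => by rw [hyα 0 ho, hv ho, add_zero])
      (fun ho => by rw [hyα 0 ho, hv' ho]; ring) hqi hqj
    exact ⟨e₀, J, _, _, htriv, hpair', hJ⟩
  · rintro ⟨e, I, a, b, ⟨t, s, e1, e2⟩, hab, hshape⟩
    have hg := hG.isGammaSystem e
    obtain ⟨x, y, x', y', ha, hb, hy, hy', hQ⟩ := exists_mono_of_shape e hshape
    set η : Fin n → ℂ := fun i => if i ∈ I then -(-1 : ℂ) ^ I.card else (-1) ^ I.card with hη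
    set z : Fin n → ℂ := fun i => (-1 : ℂ) ^ (I.card * (I.card + 1) / 2) *
      ((x - η i * x') ^ 2 + (-1) ^ I.card * (y + η i * y') ^ 2) with hz
    have hq : ∀ i, qMap a b (G (e i)) = z i • G (e i) := fun i => by
      have h1 := hg.qMap_mono I (x := x) (x' := x') hy hy' i rfl
      rw [hQ _ (by split_ifs <;> simp)] at h1
      rw [ha, hb, h1, hz, bladeLin, zero_smul, add_zero, smul_smul, smul_mul_assoc, one_mul]
    refine hG.omega_mem_of_half e hpair.1 (l := fun i => (z i).re)
      (fun i => hG.eq_ofReal_of_eq_smul e hab (hq i)) fun i j hij => ?_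
    -- The eigenvalue depends on the index only through membership in `I`.
    have hiff : ¬(i ∈ I ↔ j ∈ I) := fun h => hij (by simp only [hz, hη, h])
    have hhalf : half (fun i => G (e i)) c d i = mono (fun i => G (e i)) I
        (2⁻¹ * (x - η i * x')) (2⁻¹ * (y + η i * y')) := by
      rw [e1, e2, gammaStar_eq_bladeStar, hg.half_add_trivial, ha, hb, hg.half_mono I hy' i rfl]
    have hy2 : Odd n → 2⁻¹ * (y + η i * y') = 0 := fun ho => by rw [hy ho, hy' ho]; ring
    by_cases hi : i ∈ I
    · exact ⟨I, _, _, hi, fun hj => hiff ⟨fun _ => hj, fun _ => hi⟩, hy2, hhalf⟩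
    · have hj : j ∈ I := by by_contra hj; exact hiff ⟨fun h => absurd h hi, fun h => absurd h hj⟩
      obtain ⟨u, v, huv, hv⟩ := hg.exists_mono_compl Iᶜ (x := 2⁻¹ * (x - η i * x')) hy2
      rw [compl_compl] at huv
      exact ⟨Iᶜ, u, v, by simpa using hi, by simpa using hj, hv, hhalf.trans huv⟩

theorem exists_isGeneralizedMonomial [Nontrivial A] [FiniteDimensional ℝ V]
    (hG : IsCliffordMap G) (e : OrthonormalBasis (Fin n) ℝ V) {l₀ : Fin n → ℝ}
    (hl₀ : ∀ i, B (e i) = l₀ i • e i) (hcard : 2 < (Set.range l₀).ncard)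
    (hpair : IsPairFor G B c d) (hc : IsInvariant G B c) (hd : IsInvariant G B d)
    (hΩ : Omega G c d ∈ soBTensor A B) :
    ∃ (m : ℕ) (I : Fin m → Finset (Fin n)) (a b : A) (l : Fin m → ℝ),
      EqUpToTrivial G e c d a b ∧ IsPairFor G B a b ∧ IsGeneralizedMonomial G e I a b ∧
      Function.Injective l ∧ ∀ α, ∀ i ∈ I α, B (e i) = l α • e i := by
  obtain ⟨m, p, l, hp, hl, hlp, hm⟩ := exists_block_labels l₀
  rw [← hm] at hcard
  set I : Fin m → Finset (Fin n) := fun α => Finset.univ.filter fun i => p i = α with hIdef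
  have hI : ∀ i α, i ∈ I α ↔ p i = α := fun i α => by simp [hIdef]
  have hg := hG.isGammaSystem e
  have hBl : ∀ i, B (e i) = l (p i) • e i := fun i => by rw [hl₀, hlp]
  obtain ⟨x, y, hy, htriv, hpair', h3⟩ :=
    hG.exists_blockSum_of_omega_mem e hI hp hcard.le hl hBl hpair hc hd hΩ
  obtain ⟨hsq, hcomm⟩ := h3 hcard
  have hyα : ∀ α, Odd n → y α = 0 := fun α ho => by rw [hy ho]; rfl
  obtain ⟨i₀, -⟩ := hp ⟨0, by omega⟩
  have hdisj : ∀ α β, α ≠ β → Disjoint (I α) (I β) := fun α β hαβ =>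
    Finset.disjoint_left.2 fun i hi hi' => hαβ (((hI i α).1 hi).symm.trans ((hI i β).1 hi'))
  have hsum : ∑ α, (I α).card = n := by
    rw [← Finset.card_biUnion fun α _ β _ hαβ => hdisj α β hαβ]
    have : Finset.univ.biUnion I = Finset.univ := by
      ext i; simp [hIdef]
    rw [this, Finset.card_univ, Fintype.card_fin]
  have hcls := odd_blocks_classification (n := n) (k := fun α => (I α).card)
    (l := fun α => (l α : ℂ)) (fun α β h => hl (Complex.ofReal_injective h))
    (fun α => hg.mono_sq_iff i₀ (hyα α) (hsq α))
    (fun α β hαβ => hg.commute_mono_mono_iff i₀ (hdisj α β hαβ) (hyα α) (hyα β) (hcomm α β hαβ))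
    (by rw [hsum]) hy
  refine ⟨m, I, _, _, l, htriv, hpair', ⟨hcard, ⟨fun α => ?_, hdisj, fun i =>
    ⟨p i, (hI i _).2 rfl⟩⟩, ?_⟩, hl, fun α i hi => by rw [hBl, (hI i α).1 hi]⟩
  · obtain ⟨i, hi⟩ := hp α
    exact ⟨i, (hI i α).2 hi⟩
  · rcases hcls with ⟨hy0, h⟩ | h
    · refine Or.inl ⟨x, ?_, ?_, h⟩
      · rw [blockSum_eq, hy0]; simp [gammaProd_eq_blade]
      · rw [blockSumBar_eq, hy0]; simp [gammaProd_eq_blade]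
    · exact Or.inr ⟨x, y, blockSum_eq _ _ _ _, blockSumBar_eq _ _ _ _, h⟩

/-- The parity conditions are translated back into scalar squares and pairwise commuting summands.
The number of odd blocks fixes the parity of `n`. -/
theorem exists_blockSum_of_shape (e : OrthonormalBasis (Fin n) ℝ V)
    {I : Fin m → Finset (Fin n)} (hsum : ∑ α, (I α).card = n) {a b : A}
    (h : IsGeneralizedMonomialPlain G e I a b ∨ IsGeneralizedMonomialPseudo G e I a b) :
    ∃ x y : Fin m → ℂ, (Odd n → y = 0) ∧ a = blockSum (fun i => G (e i)) I x y ∧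
      b = blockSumBar (fun i => G (e i)) I x y ∧
      (∀ α, ((-1) ^ (I α).card + 1) * (x α * y α) = 0) ∧
      ∀ α β, α ≠ β →
        x α * x β + (-1) ^ (I α).card * (y α * y β) =
          (-1) ^ ((I α).card * (I β).card) * (x α * x β + (-1) ^ (I β).card * (y α * y β)) ∧
        (-1) ^ (I α).card * (x α * y β) + y α * x β =
          (-1) ^ ((I α).card * (I β).card) *
            ((-1) ^ (I β).card * (y α * x β) + x α * y β) := by
  have hnO : Odd n ↔ Odd (Finset.univ.filter fun α => Odd (I α).card).card := by
    rw [← Finset.odd_sum_iff_odd_card_odd, hsum]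
  rcases h with ⟨x, ha, hb, h⟩ | ⟨x, y, ha, hb, h⟩
  · refine ⟨x, 0, fun _ => rfl, ?_, ?_, fun α => by simp, fun α β hαβ => ⟨?_, by simp⟩⟩
    · rw [ha, blockSum_eq]; simp [gammaProd_eq_blade]
    · rw [hb, blockSumBar_eq]; simp [gammaProd_eq_blade]
    · have : Even ((I α).card * (I β).card) := by
        rw [← Nat.not_odd_iff_even, Nat.odd_mul]
        exact fun h' => hαβ (h α β h'.1 h'.2)
      rw [this.neg_one_pow]; simp
  · rw [gammaStar_eq_bladeStar] at ha hb
    have ha' := ha.trans (blockSum_eq _ I x y).symm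
    have hb' := hb.trans (blockSumBar_eq _ I x y).symm
    rcases h with h | ⟨α₀, α₁, hne, h0, h1, hxy, h⟩
    · have he : ¬Odd n := by
        rw [hnO, Finset.filter_eq_empty_iff.2 fun α _ => Nat.not_odd_iff_even.2 (h α).1]
        simp
      refine ⟨x, y, fun ho => absurd ho he, ha', hb', fun α => by rw [(h α).2, mul_zero],
        fun α β _ => ?_⟩
      rw [(h α).1.neg_one_pow, (h β).1.neg_one_pow, ((h α).1.mul_right _).neg_one_pow]
      constructor <;> ring
    · have hO : (Finset.univ.filter fun α => Odd (I α).card) = {α₀, α₁} := by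
        ext α
        simp only [Finset.mem_filter, Finset.mem_univ, true_and, Finset.mem_insert,
          Finset.mem_singleton]
        constructor
        · intro hα
          by_contra! h'
          exact Nat.not_even_iff_odd.2 hα (h α h'.1 h'.2).1
        · rintro (rfl | rfl) <;> assumption
      have he : ¬Odd n := by
        rw [hnO, hO, Finset.card_pair hne]; decide
      have hcase : ∀ α, α = α₀ ∨ α = α₁ ∨ (Even (I α).card ∧ y α = 0) := fun α => by
        by_cases h2 : α = α₀
        · exact Or.inl h2
        · by_cases h3 : α = α₁
          · exact Or.inr (Or.inl h3)
          · exact Or.inr (Or.inr (h α h2 h3))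
      refine ⟨x, y, fun ho => absurd ho he, ha', hb', fun α => ?_, fun α β hαβ => ?_⟩
      · rcases hcase α with rfl | rfl | h2
        · rw [h0.neg_one_pow]; ring
        · rw [h1.neg_one_pow]; ring
        · rw [h2.2]; ring
      · rcases hcase α with rfl | rfl | h2 <;> rcases hcase β with rfl | rfl | h3
        · exact absurd rfl hαβ
        · rw [h0.neg_one_pow, h1.neg_one_pow, (h0.mul h1).neg_one_pow]
          constructor
          · linear_combination 2 * hxy
          · ring
        · rw [h0.neg_one_pow, h3.1.neg_one_pow, (h3.1.mul_left _).neg_one_pow, h3.2]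
          constructor <;> ring
        · rw [h0.neg_one_pow, h1.neg_one_pow, (h1.mul h0).neg_one_pow]
          constructor
          · linear_combination 2 * hxy
          · ring
        · exact absurd rfl hαβ
        · rw [h1.neg_one_pow, h3.1.neg_one_pow, (h3.1.mul_left _).neg_one_pow, h3.2]
          constructor <;> ring
        · rw [h0.neg_one_pow, h2.1.neg_one_pow, (h2.1.mul_right _).neg_one_pow, h2.2]
          constructor <;> ring
        · rw [h1.neg_one_pow, h2.1.neg_one_pow, (h2.1.mul_right _).neg_one_pow, h2.2]
          constructor <;> ring
        · rw [h3.1.neg_one_pow, h2.1.neg_one_pow, (h2.1.mul_right _).neg_one_pow, h2.2, h3.2]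
          constructor <;> ring

theorem omega_mem_of_isGeneralizedMonomial [Nontrivial A] (hG : IsCliffordMap G)
    (e : OrthonormalBasis (Fin n) ℝ V) {I : Fin m → Finset (Fin n)} {a b : A}
    (htriv : EqUpToTrivial G e c d a b) (hab : IsPairFor G B a b)
    (hshape : IsGeneralizedMonomial G e I a b) : Omega G c d ∈ soBTensor A B := by
  obtain ⟨t, s, e1, e2⟩ := htriv
  obtain ⟨-, ⟨-, hdisj, hcov⟩, hshape⟩ := hshape
  choose p hp using hcov
  have hI : ∀ i α, i ∈ I α ↔ p i = α := fun i α => by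
    constructor
    · intro h
      by_contra hne
      exact Finset.disjoint_left.1 (hdisj _ _ hne) (hp i) h
    · rintro rfl; exact hp i
  have hg := hG.isGammaSystem e
  have hsum : ∑ α, (I α).card = n := by
    rw [← Finset.card_biUnion fun α _ β _ hαβ => hdisj α β hαβ]
    have : Finset.univ.biUnion I = Finset.univ := by
      ext i; simpa using ⟨_, hp i⟩
    rw [this, Finset.card_univ, Fintype.card_fin]
  obtain ⟨x, y, hy, ha, hb, hsq, hcm⟩ := exists_blockSum_of_shape e hsum hshape
  have hyα : ∀ α, Odd n → y α = 0 := fun α ho => by rw [hy ho]; rfl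
  set z : Fin m → ℂ := fun α => 4 * ((-1 : ℂ) ^ ((I α).card * ((I α).card + 1) / 2) *
    (x α * x α + (-1) ^ (I α).card * (y α * y α))) with hz
  have hhalf : ∀ i, half (fun i => G (e i)) a b i =
      mono (fun i => G (e i)) (I (p i)) (x (p i)) (y (p i)) := fun i => by
    rw [ha, hb, hg.half_blockSum hI hy]
  -- The commutator term in `q` drops out, and `4 X²` is the scalar `z (p i)`.
  have hq : ∀ i, qMap a b (G (e i)) = z (p i) • G (e i) := fun i => by
    refine (hg.qMap_gen_eq_iff a b i _).2 ?_
    have hcomm : Commute a (mono (fun i => G (e i)) (I (p i)) (x (p i)) (y (p i))) := by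
      rw [ha, blockSum]
      refine Commute.sum_left _ _ _ fun α _ => ?_
      by_cases hα : α = p i
      · rw [hα]
      · exact hg.commute_mono_mono (hdisj _ _ hα) (hyα _) (hyα _) (hcm _ _ hα).1 (hcm _ _ hα).2
    have h0 : (-1) ^ (I (p i)).card * (x (p i) * y (p i)) + y (p i) * x (p i) = 0 := by
      linear_combination hsq (p i)
    rw [hhalf, hcomm.eq, sub_self, smul_zero, add_zero, hg.mono_mul_mono_self _ (hyα _), h0,
      bladeLin, zero_smul, add_zero, smul_smul, smul_smul, hz, mul_assoc]
  refine hG.omega_mem_of_half e hab.1 (l := fun i => (z (p i)).re)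
    (fun i => hG.eq_ofReal_of_eq_smul e hab (hq i)) fun i j hij => ?_
  refine ⟨I (p i), x (p i), y (p i), hp i, fun hj => hij ?_, hyα _, ?_⟩
  · simp only [(hI j _).1 hj]
  · rw [e1, e2, gammaStar_eq_bladeStar, hg.half_add_trivial, hhalf]

end IsCliffordMap

/-- In a generalized monomial pair at most two blocks have an odd number of elements. -/
theorem IsGeneralizedMonomial.exists_odd_blocks {e : OrthonormalBasis (Fin n) ℝ V}
    {I : Fin m → Finset (Fin n)} {a b : A} (h : IsGeneralizedMonomial G e I a b) :
    ∃ α₀ α₁, ∀ α, Odd (I α).card → α = α₀ ∨ α = α₁ := by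
  obtain ⟨hm, -, ⟨x, -, -, h⟩ | ⟨x, y, -, -, h⟩⟩ := h
  · by_cases h0 : ∃ α, Odd (I α).card
    · obtain ⟨α₀, h0⟩ := h0
      exact ⟨α₀, α₀, fun α hα => Or.inl (h α α₀ hα h0)⟩
    · exact ⟨⟨0, by omega⟩, ⟨0, by omega⟩, fun α hα => absurd ⟨α, hα⟩ h0⟩
  · rcases h with h | ⟨α₀, α₁, -, -, -, -, h⟩
    · exact ⟨⟨0, by omega⟩, ⟨0, by omega⟩, fun α hα => absurd (h α).1 (Nat.not_even_iff_odd.2 hα)⟩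
    · refine ⟨α₀, α₁, fun α hα => ?_⟩
      by_contra! h'
      exact Nat.not_even_iff_odd.2 hα (h α h'.1 h'.2).1

end CliffordPair

/-! ### Simple Clifford modules -/

namespace CliffordPair

section Representation

variable {V S : Type*} [NormedAddCommGroup V] [InnerProductSpace ℝ V] [AddCommGroup S]
  [Module ℂ S] [Module (ComplexClifford V) S] [IsScalarTower ℂ (ComplexClifford V) S]

theorem ofReal_smul_tmul (r : ℝ) (x : CliffordAlgebra (negNormForm V)) :
    ((r : ℂ) • ((1 : ℂ) ⊗ₜ[ℝ] x) : ComplexClifford V) = (1 : ℂ) ⊗ₜ[ℝ] (r • x) := by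
  rw [TensorProduct.smul_tmul', TensorProduct.tmul_smul, TensorProduct.smul_tmul']
  congr 1

variable (V S) in
theorem commute_rep {f : Module.End ℂ S} (hf : ∀ v, gamma V S v * f = f * gamma V S v)
    (x : ComplexClifford V) : rep V S x * f = f * rep V S x := by
  have h1 : ∀ y : CliffordAlgebra (negNormForm V),
      rep V S ((1 : ℂ) ⊗ₜ[ℝ] y) * f = f * rep V S ((1 : ℂ) ⊗ₜ[ℝ] y) := fun y => by
    induction y using CliffordAlgebra.induction with
    | algebraMap r =>
      have : ((1 : ℂ) ⊗ₜ[ℝ] algebraMap ℝ (CliffordAlgebra (negNormForm V)) r :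
          ComplexClifford V) = (r : ℂ) • 1 := by
        rw [Algebra.algebraMap_eq_smul_one, ← ofReal_smul_tmul]; rfl
      rw [this, map_smul, map_one, smul_mul_assoc, mul_smul_comm, one_mul, mul_one]
    | ι v => exact hf v
    | mul a b ha hb =>
      have : ((1 : ℂ) ⊗ₜ[ℝ] (a * b) : ComplexClifford V) =
          ((1 : ℂ) ⊗ₜ[ℝ] a) * ((1 : ℂ) ⊗ₜ[ℝ] b) := by
        rw [Algebra.TensorProduct.tmul_mul_tmul, one_mul]
      rw [this, map_mul, mul_assoc, hb, ← mul_assoc, ha, mul_assoc]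
    | add a b ha hb => rw [TensorProduct.tmul_add, map_add, add_mul, mul_add, ha, hb]
  induction x using TensorProduct.induction_on with
  | zero => simp
  | tmul z y =>
    have : (z ⊗ₜ[ℝ] y : ComplexClifford V) = z • ((1 : ℂ) ⊗ₜ[ℝ] y) := by
      rw [TensorProduct.smul_tmul', smul_eq_mul, mul_one]
    rw [this, map_smul, smul_mul_assoc, mul_smul_comm, h1]
  | add a b ha hb => rw [map_add, add_mul, mul_add, ha, hb]

variable (V) in
theorem finiteDimensional_complexClifford [FiniteDimensional ℝ V] :
    FiniteDimensional ℂ (ComplexClifford V) := by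
  have : Module.Finite ℝ (ExteriorAlgebra ℝ V) :=
    Module.Finite.of_basis (Module.finBasis ℝ V).ExteriorAlgebra
  have : Module.Finite ℝ (CliffordAlgebra (negNormForm V)) :=
    Module.Finite.equiv (CliffordAlgebra.equivExterior (negNormForm V)).symm
  infer_instance

variable (V S) in
theorem finiteDimensional_of_isSimpleModule [FiniteDimensional ℝ V]
    [IsSimpleModule (ComplexClifford V) S] : FiniteDimensional ℂ S := by
  have := finiteDimensional_complexClifford V
  exact Module.Finite.trans (ComplexClifford V) S

variable (V S) in
theorem isCliffordMap_gamma [FiniteDimensional ℝ V] [IsSimpleModule (ComplexClifford V) S] :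
    IsCliffordMap (gamma V S) where
  add v w := by simp only [gamma, map_add, TensorProduct.tmul_add]
  smul r v := by
    rw [gamma, map_smul, ← ofReal_smul_tmul, map_smul]; rfl
  anticomm v w := by
    have hpolar : QuadraticMap.polar (negNormForm V) v w = -2 * inner ℝ v w := by
      simp only [QuadraticMap.polar, negNormForm, neg_apply,
        LinearMap.BilinMap.toQuadraticMap_apply, innerₗ_apply_apply, inner_add_left,
        inner_add_right, real_inner_comm v w]
      ring
    simp only [gamma]
    rw [← map_mul, ← map_mul, ← map_add, Algebra.TensorProduct.tmul_mul_tmul,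
      Algebra.TensorProduct.tmul_mul_tmul, one_mul, ← TensorProduct.tmul_add,
      CliffordAlgebra.ι_mul_ι_add_swap, hpolar, Algebra.algebraMap_eq_smul_one,
      ← ofReal_smul_tmul, map_smul]
    congr 1
    exact map_one _
  central f hf := by
    have := finiteDimensional_of_isSimpleModule V S
    -- An endomorphism commuting with all vectors is linear over the Clifford algebra, so Schur's
    -- lemma over `ℂ` makes it scalar.
    let F : Module.End (ComplexClifford V) S :=
      { toFun := f
        map_add' := f.map_add
        map_smul' := fun x s => (LinearMap.congr_fun (commute_rep V S hf x) s).symm }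
    obtain ⟨z, hz⟩ := (IsSimpleModule.algebraMap_end_bijective_of_isAlgClosed (A := ComplexClifford V)
      (V := S) ℂ).2 F
    refine ⟨z, LinearMap.ext fun s => ?_⟩
    exact (LinearMap.congr_fun hz s).symm

end Representation

/-- The blocks index bases of the eigenspaces, so multiplicities are block sizes and at most two
blocks are odd. -/
theorem ncard_odd_le_two {V A : Type*} [NormedAddCommGroup V] [InnerProductSpace ℝ V] [Ring A]
    [Algebra ℂ A] {n m : ℕ} {G : V → A} {B : V →ₗ[ℝ] V} (hB : B.IsSymmetric)
    {e : OrthonormalBasis (Fin n) ℝ V} {I : Fin m → Finset (Fin n)} {a b : A} {l : Fin m → ℝ}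
    (hl : Function.Injective l) (hBl : ∀ α, ∀ i ∈ I α, B (e i) = l α • e i)
    (h : IsGeneralizedMonomial G e I a b) :
    {r : ℝ | Module.End.HasEigenvalue B r ∧
      Odd (Module.finrank ℝ (Module.End.eigenspace B r))}.ncard ≤ 2 := by
  obtain ⟨α₀, α₁, hodd⟩ := h.exists_odd_blocks
  obtain ⟨-, ⟨-, -, hcov⟩, -⟩ := h
  choose p hp using hcov
  have hBe : ∀ i, B (e i) = l (p i) • e i := fun i => hBl _ i (hp i)
  have hI : ∀ i α, i ∈ I α ↔ p i = α := fun i α => by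
    constructor
    · intro hi
      have h1 := (hBe i).symm.trans (hBl α i hi)
      rw [← sub_eq_zero, ← sub_smul] at h1
      exact hl (sub_eq_zero.1 ((smul_eq_zero.1 h1).resolve_right (e.orthonormal.ne_zero i)))
    · rintro rfl; exact hp i
  have hsub : {r : ℝ | Module.End.HasEigenvalue B r ∧
      Odd (Module.finrank ℝ (Module.End.eigenspace B r))} ⊆ {l α₀, l α₁} := by
    rintro r ⟨hr, ho⟩
    obtain ⟨i, rfl⟩ := (hasEigenvalue_iff_exists hB e (l := fun i => l (p i)) hBe r).1 hr
    rw [finrank_eigenspace hB e (l := fun i => l (p i)) hBe] at ho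
    have : (Finset.univ.filter fun j => l (p j) = l (p i)) = I (p i) := by
      ext j; simp [hI, hl.eq_iff]
    rw [this] at ho
    rcases hodd _ ho with h | h <;> simp [h]
  exact (Set.ncard_le_ncard hsub).trans ((Set.ncard_insert_le _ _).trans (by simp))

end CliffordPair

end

theorem theorem4p1 {V S : Type*} [NormedAddCommGroup V] [InnerProductSpace ℝ V]
    [FiniteDimensional ℝ V] [AddCommGroup S] [Module ℂ S]
    [Module (CliffordPair.ComplexClifford V) S]
    [IsScalarTower ℂ (CliffordPair.ComplexClifford V) S]
    [IsSimpleModule (CliffordPair.ComplexClifford V) S]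
    (B : V →ₗ[ℝ] V) (c d : CliffordPair.ComplexClifford V)
    (hpair : CliffordPair.IsPairFor (CliffordPair.gamma V S) B
      (CliffordPair.rep V S c) (CliffordPair.rep V S d))
    (hc : CliffordPair.IsInvariant (CliffordPair.gamma V S) B (CliffordPair.rep V S c))
    (hd : CliffordPair.IsInvariant (CliffordPair.gamma V S) B (CliffordPair.rep V S d)) :
    let G : V → Module.End ℂ S := CliffordPair.gamma V S
    let C : Module.End ℂ S := CliffordPair.rep V S c
    let D : Module.End ℂ S := CliffordPair.rep V S d
    let n : ℕ := Module.finrank ℝ V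
    let OmegaInSoB : Prop :=
      CliffordPair.Omega G C D ∈ CliffordPair.soBTensor (Module.End ℂ S) B
    ((∃ l : ℝ, B = l • LinearMap.id) →
      (OmegaInSoB ↔
        ∃ (e : OrthonormalBasis (Fin n) ℝ V) (a b : Module.End ℂ S),
          CliffordPair.EqUpToTrivial G e C D a b ∧ CliffordPair.IsPairFor G B a b ∧
          (CliffordPair.IsScalarPair a b ∨ CliffordPair.IsPseudoScalarPair G e a b))) ∧
    ({l : ℝ | Module.End.HasEigenvalue B l}.ncard = 2 →
      (OmegaInSoB ↔
        ∃ (e : OrthonormalBasis (Fin n) ℝ V) (I : Finset (Fin n)) (a b : Module.End ℂ S),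
          CliffordPair.EqUpToTrivial G e C D a b ∧ CliffordPair.IsPairFor G B a b ∧
          (CliffordPair.IsMonomial G e I a b ∨ CliffordPair.IsPseudoMonomial G e I a b))) ∧
    (2 < {l : ℝ | Module.End.HasEigenvalue B l}.ncard →
      (OmegaInSoB ↔
        ∃ (e : OrthonormalBasis (Fin n) ℝ V) (m : ℕ) (I : Fin m → Finset (Fin n))
          (a b : Module.End ℂ S),
          CliffordPair.EqUpToTrivial G e C D a b ∧ CliffordPair.IsPairFor G B a b ∧
          CliffordPair.IsGeneralizedMonomial G e I a b) ∧
      (OmegaInSoB →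
        ∃ (e : OrthonormalBasis (Fin n) ℝ V) (m : ℕ) (I : Fin m → Finset (Fin n))
          (a b : Module.End ℂ S) (l : Fin m → ℝ),
          CliffordPair.EqUpToTrivial G e C D a b ∧ CliffordPair.IsPairFor G B a b ∧
          CliffordPair.IsGeneralizedMonomial G e I a b ∧
          Function.Injective l ∧ ∀ α, ∀ i ∈ I α, B (e i) = l α • e i)) ∧
    (OmegaInSoB →
      {l : ℝ | Module.End.HasEigenvalue B l ∧
        Odd (Module.finrank ℝ (Module.End.eigenspace B l))}.ncard ≤ 2) := by
  intro G C D n OmegaInSoB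
  have : Nontrivial S := IsSimpleModule.nontrivial (CliffordPair.ComplexClifford V) S
  have hG : CliffordPair.IsCliffordMap G := CliffordPair.isCliffordMap_gamma V S
  have hB : B.IsSymmetric := hpair.1
  let e : OrthonormalBasis (Fin n) ℝ V := hB.eigenvectorBasis rfl
  have hl : ∀ i, B (e i) = hB.eigenvalues rfl i • e i := hB.apply_eigenvectorBasis rfl
  have hset : {l : ℝ | Module.End.HasEigenvalue B l} = Set.range (hB.eigenvalues rfl) :=
    Set.ext fun r => CliffordPair.hasEigenvalue_iff_exists hB e hl r
  have hforward : 2 < {l : ℝ | Module.End.HasEigenvalue B l}.ncard → OmegaInSoB →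
      ∃ (e : OrthonormalBasis (Fin n) ℝ V) (m : ℕ) (I : Fin m → Finset (Fin n))
        (a b : Module.End ℂ S) (l : Fin m → ℝ),
        CliffordPair.EqUpToTrivial G e C D a b ∧ CliffordPair.IsPairFor G B a b ∧
        CliffordPair.IsGeneralizedMonomial G e I a b ∧
        Function.Injective l ∧ ∀ α, ∀ i ∈ I α, B (e i) = l α • e i := fun h hΩ =>
    ⟨e, hG.exists_isGeneralizedMonomial e hl (hset ▸ h) hpair hc hd hΩ⟩
  refine ⟨?_, fun h => hG.omega_mem_iff_of_two e hl (hset ▸ h) hpair hc hd,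
    fun h => ⟨⟨fun hΩ => ?_, ?_⟩, hforward h⟩, fun hΩ => ?_⟩
  · rintro ⟨r, hr⟩
    exact hG.omega_mem_iff_of_scalar e hr hpair hc hd
  · obtain ⟨e, m, I, a, b, l, h1, h2, h3, -⟩ := hforward h hΩ
    exact ⟨e, m, I, a, b, h1, h2, h3⟩
  · rintro ⟨e, m, I, a, b, h1, h2, h3⟩
    exact hG.omega_mem_of_isGeneralizedMonomial e h1 h2 h3
  -- With at most two eigenvalues the bound on exceptions is trivial.
  · rcases le_or_gt {l : ℝ | Module.End.HasEigenvalue B l}.ncard 2 with h | h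
    · refine (Set.ncard_le_ncard (fun r hr => hr.1) ?_).trans h
      rw [hset]
      exact Set.finite_range _
    · obtain ⟨e, m, I, a, b, l, -, -, h3, h4, h5⟩ := hforward h hΩ
      exact CliffordPair.ncard_odd_le_two hB h4 h5 h3
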